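/- Let $q = q_0^2$, where $q_0 \ge 3$ is a prime power. Let $G \leqslant \mathrm{Sym}(\Omega)$ be a finite almost simple primitive permutation group with socle $G_0 \cong \mathrm{L}_2(q) = \mathrm{PSL}_2(q)$, and suppose that the point stabiliser $H$ is of type $\mathrm{GL}_2(q_0)$; that is, under some identification of $G_0$ with $\mathrm{L}_2(q)$, we have $H = N_G(S)$, where for some $g \in \mathrm{GL}_2(q)$ the group $S$ is the image in $\mathrm{L}_2(q)$ of $\mathrm{SL}_2(q) \cap \mathbb{F}_q^\times\, g\,\mathrm{GL}_2(q_0)\,g^{-1}$ (the stabiliser, up to scalars, of an $\mathbb{F}_{q_0}$-form of $\mathbb{F}_q^2$). Let $b(G)$ be the base size of $G$, i.e. the smallest size of a subset of $\Omega$ whose pointwise stabiliser in $G$ is trivial. If $q = 9$ and $G \cong \mathrm{P\Sigma L}_2(9) = \mathrm{L}_2(9) \rtimes \mathrm{Aut}(\mathbb{F}_9)$, then $b(G) = 4$; in all other cases $b(G) = 3$. -/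

import Mathlib

open scoped MatrixGroups

/-- The base size of a group `G` acting on `Ω`: the smallest cardinality of a base, i.e. of a
(finite) subset of `Ω` whose pointwise stabiliser in `G` is trivial. -/
noncomputable def baseSize (G Ω : Type*) [Group G] [MulAction G Ω] : ℕ :=
  sInf {n : ℕ | ∃ Δ : Finset Ω, Δ.card = n ∧ fixingSubgroup G (Δ : Set Ω) = ⊥}

/-- `N` is a minimal normal subgroup of `G`: minimal among the nontrivial normal subgroups. -/
def IsMinimalNormal {G : Type*} [Group G] (N : Subgroup G) : Prop :=
  Minimal (fun M : Subgroup G => M.Normal ∧ M ≠ ⊥) N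

/-- The socle of `G`: the product of (i.e. the subgroup generated by) all minimal normal
subgroups of `G`. -/
def socle (G : Type*) [Group G] : Subgroup G :=
  sSup {N : Subgroup G | IsMinimalNormal N}

/-- A (finite) group is almost simple if its socle is a nonabelian simple group. -/
def IsAlmostSimple (G : Type*) [Group G] : Prop :=
  IsSimpleGroup (socle G) ∧ ∃ x y : socle G, x * y ≠ y * x

section Linear

variable {K : Type*} [Field K]

/-- The automorphism of `SL₂(K)` that applies a field automorphism to every matrix entry. -/
def slFieldAut (σ : K ≃+* K) : SL(2, K) ≃* SL(2, K) where
  toFun := Matrix.SpecialLinearGroup.map (σ : K →+* K)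
  invFun := Matrix.SpecialLinearGroup.map (σ.symm : K →+* K)
  left_inv A := by ext i j; simp
  right_inv A := by ext i j; simp
  map_mul' := map_mul _

/-- The automorphism of `L₂(K) = PSL₂(K)` induced by a field automorphism. -/
def pslFieldAut (σ : K ≃+* K) : MulAut PSL(2, K) :=
  QuotientGroup.congr _ _ (slFieldAut σ)
    (Subgroup.characteristic_iff_map_eq.mp inferInstance (slFieldAut σ))

/-- The action of `Aut(K)` on `L₂(K)` by field automorphisms. -/
def pslFieldAutHom (K : Type*) [Field K] : (K ≃+* K) →* MulAut PSL(2, K) where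
  toFun := pslFieldAut
  map_one' := by
    ext x
    induction x using QuotientGroup.induction_on with
    | H A => rfl
  map_mul' σ τ := by
    ext x
    induction x using QuotientGroup.induction_on with
    | H A => rfl

/-- `PΣL₂(K)`: the extension of `L₂(K)` by the group of all field automorphisms of `K`. -/
abbrev PSigmaL2 (K : Type*) [Field K] : Type _ :=
  PSL(2, K) ⋊[pslFieldAutHom K] (K ≃+* K)

/-- The subgroup `Kˣ · g GL₂(F) g⁻¹` of `GL₂(K)`, for a subfield `F` of `K` and `g ∈ GL₂(K)`;
this is the stabiliser in `GL₂(K)` of the `F`-form `g F²` of `K²`, up to scalars in `Kˣ`. -/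
def subfieldGL (F : Subfield K) (g : GL (Fin 2) K) : Subgroup (GL (Fin 2) K) :=
  Subgroup.center (GL (Fin 2) K) ⊔
    ((Matrix.GeneralLinearGroup.map F.subtype).range).map (MulAut.conj g).toMonoidHom

/-- The subfield subgroup of `L₂(K)` that is the image of `SL₂(K) ∩ Kˣ · g GL₂(F) g⁻¹`. -/
def subfieldPSL (F : Subfield K) (g : GL (Fin 2) K) : Subgroup PSL(2, K) :=
  ((subfieldGL F g).comap Matrix.SpecialLinearGroup.toGL).map
    (QuotientGroup.mk' (Subgroup.center SL(2, K)))

/-- A subgroup `H` of a group `G` with socle isomorphic to `L₂(K)` is of type `GL₂(F)`, for `F` a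
subfield of `K`, if `H` is the normaliser in `G` of a subfield subgroup of the socle over `F`. -/
def IsOfTypeGL2 {G : Type*} [Group G] (F : Subfield K) (H : Subgroup G) : Prop :=
  ∃ (φ : PSL(2, K) ≃* socle G) (g : GL (Fin 2) K),
    H = Subgroup.normalizer
      (((subfieldPSL F g).map ((socle G).subtype.comp φ.toMonoidHom) : Subgroup G) : Set G)

end Linear

/-! The points of `Ω` correspond to the `L₂(K)`-conjugates of the standard subfield subgroup, that
is, to certain `F`-forms `g F²` of `K²` up to scalars, or Baer sublines of the projective line over
`K`. The group `G` embeds in `Aut(L₂(K))`, whose elements are all induced by semilinear maps `(h,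
σ)` (`exists_eq_pslSemi`). Such a map fixes the form `g F²` exactly when `g⁻¹ h σ(g)` has entries in
`F` up to a scalar (`map_pslSemi_subfieldPSL_eq_iff`), so every question about stabilisers becomes
one about ratios of matrix entries. Elements of `F` are squares in `K`, and the socle is transitive;
hence `G` lies between `L₂(K)` and `PΣL₂(K)` (`SublineAction.exists_toAut_eq`).

Two points never suffice. Let `τ` be the involution of `K` fixing `F`. The form `C F²` is the fixed
set of the semilinear involution `X τ` with `X = C τ(C)⁻¹`, so a matrix over `F` commuting with `X`
preserves both `F²` and `C F²`. As `τ(X) = X⁻¹`, the matrices `α X + τ(α) X⁻¹` are defined over `F`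
and commute with `X`, and some choice is not scalar (`exists_nonscalar_commute`).

Three points suffice when `q₀ ≥ 4`. View `K` as an affine plane over `F`, whose lines are the
sublines through `∞`. A semilinear map preserving the sides of a triangle `0, 1, a` is scalar with
`σ a = a` (`scalar_of_triangle`), and `a` can be chosen with trivial stabiliser in `Aut(K)`, and
with `a` and `1 - a` squares, so that the three lines lie in one `L₂(K)`-orbit
(`Subfield.exists_generating_square_pair`). When `q₀ = 3`, `Aut(K)` has order two, so `G` is either
`L₂(9)`, where three lines again suffice (`scalar_of_two_parallel_lines`), or `PΣL₂(9)`.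

For `PΣL₂(9)` four lines form a base (`scalar_of_four_lines`) but three points do not. The matrices
`X` are the norm-one vectors of a four-dimensional quadratic space over the field of three elements,
and a finite check yields, for any three of them, a norm-one vector equal up to sign or orthogonal
to each. The corresponding semilinear involution fixes all three points
(`exists_normalising_triple`). -/

/-! ### Semilinear automorphisms of `PSL₂(K)` and unitriangular generators -/

section ProjectiveGroups

variable {K : Type*} [Field K]

/-- The automorphism of `SL₂(K)` given by conjugation with an element of `GL₂(K)`. -/
def slConj : GL (Fin 2) K →* MulAut SL(2, K) where
  toFun g :=
    { toFun := fun A => ⟨g.1 * A.1 * (g⁻¹).1, by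
        rw [Matrix.det_mul, Matrix.det_mul, A.2, mul_one, ← Matrix.det_mul, ← Units.val_mul,
          mul_inv_cancel, Units.val_one, Matrix.det_one]⟩
      invFun := fun A => ⟨(g⁻¹).1 * A.1 * g.1, by
        rw [Matrix.det_mul, Matrix.det_mul, A.2, mul_one, ← Matrix.det_mul, ← Units.val_mul,
          inv_mul_cancel, Units.val_one, Matrix.det_one]⟩
      left_inv := fun A => Subtype.ext <| by
        simp only [mul_assoc, Units.inv_mul, Units.inv_mul_cancel_left, mul_one]
      right_inv := fun A => Subtype.ext <| by
        simp only [mul_assoc, Units.mul_inv, Units.mul_inv_cancel_left, mul_one]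
      map_mul' := fun A B => Subtype.ext <| by
        change g.1 * (A.1 * B.1) * (g⁻¹).1 = g.1 * A.1 * (g⁻¹).1 * (g.1 * B.1 * (g⁻¹).1)
        simp only [mul_assoc, Units.inv_mul_cancel_left] }
  map_one' := by
    ext A : 1
    apply Subtype.ext
    change (1 : GL (Fin 2) K).1 * A.1 * ((1 : GL (Fin 2) K)⁻¹).1 = A.1
    simp
  map_mul' g h := by
    ext A : 1
    apply Subtype.ext
    change (g * h).1 * A.1 * ((g * h)⁻¹).1 = g.1 * (h.1 * A.1 * (h⁻¹).1) * (g⁻¹).1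
    simp only [mul_inv_rev, Units.val_mul, mul_assoc]

theorem toGL_slConj (g : GL (Fin 2) K) (A : SL(2, K)) :
    Matrix.SpecialLinearGroup.toGL (slConj g A) =
      g * Matrix.SpecialLinearGroup.toGL A * g⁻¹ :=
  Units.ext rfl

/-- The automorphism of `PSL₂(K)` induced by an automorphism of `SL₂(K)`. -/
def pslLift (K : Type*) [Field K] : MulAut SL(2, K) →* MulAut PSL(2, K) where
  toFun α := QuotientGroup.congr _ _ α (Subgroup.characteristic_iff_map_eq.mp inferInstance α)
  map_one' := by
    ext x
    induction x using QuotientGroup.induction_on with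
    | H A => rfl
  map_mul' σ τ := by
    ext x
    induction x using QuotientGroup.induction_on with
    | H A => rfl

/-- The projection `SL₂(K) → PSL₂(K)`. -/
abbrev pslMk : SL(2, K) →* PSL(2, K) := QuotientGroup.mk' _

theorem pslMk_surjective : Function.Surjective (pslMk : SL(2, K) →* PSL(2, K)) :=
  QuotientGroup.mk'_surjective _

theorem pslLift_pslMk (α : MulAut SL(2, K)) (A : SL(2, K)) :
    pslLift K α (pslMk A) = pslMk (α A) := rfl

theorem pslFieldAut_pslMk (σ : K ≃+* K) (A : SL(2, K)) :
    pslFieldAut σ (pslMk A) = pslMk (slFieldAut σ A) := rfl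

theorem pslMk_eq_iff (A B : SL(2, K)) :
    pslMk A = pslMk B ↔ ∃ e : K, e ^ 2 = 1 ∧ B.1 = e • A.1 := by
  rw [QuotientGroup.mk'_apply, QuotientGroup.mk'_apply, QuotientGroup.eq,
    Matrix.SpecialLinearGroup.mem_center_iff]
  constructor
  · rintro ⟨e, he, h⟩
    refine ⟨e, by simpa using he, ?_⟩
    have : B = A * (A⁻¹ * B) := by simp
    rw [this, Matrix.SpecialLinearGroup.coe_mul, ← h]
    ext i j
    simp [Matrix.scalar_apply, Matrix.mul_diagonal, mul_comm]
  · rintro ⟨e, he, h⟩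
    refine ⟨e, by simpa using he, ?_⟩
    rw [Matrix.SpecialLinearGroup.coe_mul, h, Matrix.mul_smul,
      ← Matrix.SpecialLinearGroup.coe_mul, inv_mul_cancel]
    ext i j
    simp [Matrix.scalar_apply, Matrix.diagonal_apply, Matrix.one_apply]

theorem slFieldAut_apply (σ : K ≃+* K) (A : SL(2, K)) (i j : Fin 2) :
    (slFieldAut σ A).1 i j = σ (A.1 i j) := rfl

/-- The automorphism of `PSL₂(K)` induced by a semilinear map with matrix `g` and field
automorphism `σ`. -/
def pslSemi (g : GL (Fin 2) K) (σ : K ≃+* K) : MulAut PSL(2, K) :=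
  pslLift K (slConj g) * pslFieldAut σ

theorem pslSemi_pslMk (g : GL (Fin 2) K) (σ : K ≃+* K) (A : SL(2, K)) :
    pslSemi g σ (pslMk A) = pslMk (slConj g (slFieldAut σ A)) := rfl

/-- The action of a field automorphism on `GL₂(K)`. -/
abbrev glMap (σ : K ≃+* K) : GL (Fin 2) K →* GL (Fin 2) K :=
  Matrix.GeneralLinearGroup.map (σ : K →+* K)

theorem pslSemi_mul (g h : GL (Fin 2) K) (σ τ : K ≃+* K) :
    pslSemi g σ * pslSemi h τ = pslSemi (g * glMap σ h) (σ * τ) := by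
  ext x
  obtain ⟨A, rfl⟩ := pslMk_surjective x
  simp only [MulAut.mul_apply, pslSemi_pslMk]
  congr 1
  apply Matrix.SpecialLinearGroup.toGL_injective
  rw [toGL_slConj, toGL_slConj]
  have h1 : ∀ A : SL(2, K), Matrix.SpecialLinearGroup.toGL (slFieldAut σ A) =
    glMap σ (Matrix.SpecialLinearGroup.toGL A) := fun A => Units.ext rfl
  have h2 : ∀ A : SL(2, K), Matrix.SpecialLinearGroup.toGL (slFieldAut τ A) =
    glMap τ (Matrix.SpecialLinearGroup.toGL A) := fun A => Units.ext rfl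
  have h3 : ∀ A : SL(2, K), Matrix.SpecialLinearGroup.toGL (slFieldAut (σ * τ) A) =
    glMap σ (glMap τ (Matrix.SpecialLinearGroup.toGL A)) := fun A => Units.ext rfl
  rw [h1, toGL_slConj, h2, h3]
  simp only [map_mul, map_inv, mul_inv_rev, mul_assoc]

theorem conj_pslMk (A : SL(2, K)) :
    MulAut.conj (pslMk A) = pslSemi (Matrix.SpecialLinearGroup.toGL A) 1 := by
  ext x
  obtain ⟨B, rfl⟩ := pslMk_surjective x
  rfl

/-- Upper unitriangular elements of `SL₂(K)`. -/
def slUpper (x : K) : SL(2, K) := ⟨!![1, x; 0, 1], by simp [Matrix.det_fin_two]⟩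

/-- Lower unitriangular elements of `SL₂(K)`. -/
def slLower (x : K) : SL(2, K) := ⟨!![1, 0; x, 1], by simp [Matrix.det_fin_two]⟩

theorem coe_slUpper (x : K) : (slUpper x : Matrix (Fin 2) (Fin 2) K) = !![1, x; 0, 1] := rfl

theorem coe_slLower (x : K) : (slLower x : Matrix (Fin 2) (Fin 2) K) = !![1, 0; x, 1] := rfl

theorem slUpper_add (x y : K) : slUpper (x + y) = slUpper x * slUpper y :=
  Subtype.ext (by simp [coe_slUpper, add_comm])

theorem slLower_add (x y : K) : slLower (x + y) = slLower x * slLower y :=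
  Subtype.ext (by simp [coe_slLower])

theorem slUpper_zero : slUpper (0 : K) = 1 :=
  Subtype.ext (by simp [coe_slUpper, Matrix.one_fin_two])

theorem slLower_zero : slLower (0 : K) = 1 :=
  Subtype.ext (by simp [coe_slLower, Matrix.one_fin_two])

theorem slUpper_inv (x : K) : (slUpper x)⁻¹ = slUpper (-x) := by
  rw [inv_eq_iff_mul_eq_one, ← slUpper_add, add_neg_cancel, slUpper_zero]

/-- Unitriangular matrices generate `SL₂(K)`. -/
theorem sl_induction {P : SL(2, K) → Prop} (hU : ∀ x, P (slUpper x)) (hL : ∀ x, P (slLower x))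
    (hmul : ∀ A B, P A → P B → P (A * B)) (A : SL(2, K)) : P A := by
  -- A nonzero lower left entry allows a factorisation upper · lower · upper; otherwise
  -- multiplication by `slLower 1` makes that entry equal to the nonzero lower right one.
  have key : ∀ A : SL(2, K), A.1 1 0 ≠ 0 → P A := by
    intro A hc
    have hd := A.2
    rw [Matrix.det_fin_two] at hd
    have : A = slUpper ((A.1 0 0 - 1) / A.1 1 0) * slLower (A.1 1 0) *
        slUpper ((A.1 1 1 - 1) / A.1 1 0) := by
      apply Subtype.ext
      simp only [Matrix.SpecialLinearGroup.coe_mul, coe_slUpper, coe_slLower]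
      rw [Matrix.eta_fin_two A.1]
      ext i j
      fin_cases i <;> fin_cases j <;> simp <;> field_simp <;>
        first | ring1 | linear_combination -hd
    rw [this]
    exact hmul _ _ (hmul _ _ (hU _) (hL _)) (hU _)
  by_cases hc : A.1 1 0 = 0
  · have : A = (A * slLower 1) * slLower (-1) := by
      rw [mul_assoc, ← slLower_add]; simp [slLower_zero]
    rw [this]
    refine hmul _ _ (key _ ?_) (hL _)
    have hd := A.2
    rw [Matrix.det_fin_two, hc] at hd
    simp only [Matrix.SpecialLinearGroup.coe_mul, coe_slLower, Matrix.mul_apply, Fin.sum_univ_two,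
      hc]
    rintro h
    simp at h
    simp [h] at hd
  · exact key A hc

theorem psl_hom_ext {M : Type*} [Monoid M] {α β : PSL(2, K) →* M}
    (hU : ∀ x, α (pslMk (slUpper x)) = β (pslMk (slUpper x)))
    (hL : ∀ x, α (pslMk (slLower x)) = β (pslMk (slLower x))) : α = β := by
  refine MonoidHom.ext fun x => ?_
  obtain ⟨A, rfl⟩ := pslMk_surjective x
  exact sl_induction (P := fun A => α (pslMk A) = β (pslMk A)) hU hL
    (fun A B hA hB => by simp only [map_mul] at hA hB ⊢; rw [hA, hB]) A

end ProjectiveGroups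

/-! ### Automorphisms of `PSL₂(K)` are semilinear -/

section Automorphisms

variable {K : Type*} [Field K]

theorem slConj_eq_iff (g : GL (Fin 2) K) (A B : SL(2, K)) :
    slConj g A = B ↔ g.1 * A.1 = B.1 * g.1 := by
  have h : (slConj g A).1 = g.1 * A.1 * (g⁻¹).1 := rfl
  constructor
  · rintro rfl
    rw [h, mul_assoc, Units.inv_mul, mul_one]
  · intro hg
    apply Subtype.ext
    rw [h, hg, mul_assoc, Units.mul_inv, mul_one]

theorem pslMk_slUpper_injective {x y : K} (h : pslMk (slUpper x) = pslMk (slUpper y)) :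
    x = y := by
  obtain ⟨e, -, he⟩ := (pslMk_eq_iff _ _).1 h
  have h0 := congrFun (congrFun he 0) 0
  have h1 := congrFun (congrFun he 0) 1
  simp [slUpper] at h0 h1
  rw [h1, ← h0, one_mul]

theorem pslMk_slLower_injective {x y : K} (h : pslMk (slLower x) = pslMk (slLower y)) :
    x = y := by
  obtain ⟨e, -, he⟩ := (pslMk_eq_iff _ _).1 h
  have h0 := congrFun (congrFun he 0) 0
  have h1 := congrFun (congrFun he 1) 0
  simp [slLower] at h0 h1
  rw [h1, ← h0, one_mul]

theorem pslMk_slUpper_ne_slLower {x y : K} (hy : y ≠ 0) :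
    pslMk (slLower y) ≠ pslMk (slUpper x) := by
  intro h
  obtain ⟨e, h2, he⟩ := (pslMk_eq_iff _ _).1 h
  have h0 := congrFun (congrFun he 1) 0
  simp [slUpper, slLower, hy] at h0
  simp [h0] at h2

/-- An element of order `p` of `PSL₂(K)` lifts to an element of trace `2`. -/
theorem exists_trace_eq_two {p : ℕ} [Fact p.Prime] [CharP K p] (A : SL(2, K))
    (hA : pslMk A ^ p = 1) : ∃ B : SL(2, K), pslMk B = pslMk A ∧ B.1 0 0 + B.1 1 1 = 2 := by
  rw [← map_pow, ← map_one (pslMk (K := K)), pslMk_eq_iff] at hA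
  obtain ⟨e, he, h⟩ := hA
  rw [Matrix.SpecialLinearGroup.coe_one, Matrix.SpecialLinearGroup.coe_pow] at h
  have hep : e ^ p = e := by
    rcases mul_self_eq_one_iff.1 ((pow_two e).symm.trans he) with rfl | rfl
    · simp
    · rw [← frobenius_def, map_neg, map_one]
  have hdet : (e • A.1).det = 1 := by
    rw [Matrix.det_smul, A.2, Fintype.card_fin, he, one_mul]
  refine ⟨⟨e • A.1, hdet⟩, ((pslMk_eq_iff _ _).2 ⟨e, he, rfl⟩).symm, ?_⟩
  have hp : (e • A.1) ^ p = 1 := by rw [smul_pow, hep, ← h]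
  -- The lift `B = e • A` satisfies `(B - 1) ^ p = B ^ p - 1 = 0`, so `det (B - 1) = 2 - tr B`
  -- vanishes.
  have hn : (e • A.1 - 1) ^ p = 0 := by
    rw [sub_pow_char_of_commute p (Commute.one_right _), hp, one_pow, sub_self]
  have hd : (e • A.1 - 1).det = 0 := by
    have := congrArg Matrix.det hn
    rw [Matrix.det_pow, Matrix.det_zero] at this
    exact pow_eq_zero_iff (Fact.out : p.Prime).ne_zero |>.1 this
  change (e • A.1) 0 0 + (e • A.1) 1 1 = 2
  generalize e • A.1 = B at *
  rw [Matrix.det_fin_two] at hdet hd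
  simp at hd
  linear_combination hdet - hd

/-- A nontrivial element of trace `2` is conjugate in `GL₂(K)` to a transvection. -/
theorem exists_slConj_slUpper (A : SL(2, K)) (htr : A.1 0 0 + A.1 1 1 = 2) (hA : A ≠ 1) :
    ∃ g : GL (Fin 2) K, slConj g (slUpper 1) = A := by
  have hd := A.2
  rw [Matrix.det_fin_two] at hd
  by_cases hc : A.1 1 0 = 0
  · have ha : A.1 0 0 = 1 := by
      have : (A.1 0 0 - 1) ^ 2 = 0 := by
        rw [hc] at hd
        linear_combination A.1 0 0 * htr - hd
      exact sub_eq_zero.1 (pow_eq_zero_iff two_ne_zero |>.1 this)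
    have hd1 : A.1 1 1 = 1 := by linear_combination htr - ha
    have hb : A.1 0 1 ≠ 0 := by
      intro hb
      apply hA
      apply Subtype.ext
      rw [Matrix.eta_fin_two A.1, ha, hb, hc, hd1]
      simp [Matrix.one_fin_two]
    refine ⟨Matrix.GeneralLinearGroup.mkOfDetNeZero !![A.1 0 1, 0; 0, 1]
      (by simpa [Matrix.det_fin_two]), (slConj_eq_iff _ _ _).2 ?_⟩
    change !![A.1 0 1, 0; 0, 1] * !![1, 1; 0, 1] = A.1 * !![A.1 0 1, 0; 0, 1]
    rw [Matrix.eta_fin_two A.1, ha, hc, hd1]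
    simp
  · refine ⟨Matrix.GeneralLinearGroup.mkOfDetNeZero !![A.1 0 0 - 1, 1; A.1 1 0, 0]
      (by simpa [Matrix.det_fin_two]), (slConj_eq_iff _ _ _).2 ?_⟩
    change !![A.1 0 0 - 1, 1; A.1 1 0, 0] * !![1, 1; 0, 1] =
      A.1 * !![A.1 0 0 - 1, 1; A.1 1 0, 0]
    have hd1 : A.1 1 1 = 2 - A.1 0 0 := by linear_combination htr
    rw [Matrix.eta_fin_two A.1]
    rw [hd1] at hd ⊢
    ext i j
    fin_cases i <;> fin_cases j <;> simp <;> first | ring1 | linear_combination hd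

/-- Commuting in `PSL₂(K)` means commuting up to a scalar `e` in `SL₂(K)`. If `e ≠ 1`, the first
column of `A` vanishes; if `e = 1`, `A` is `±1` times a unitriangular matrix. -/
theorem exists_slUpper_of_commute (A : SL(2, K))
    (h : Commute (pslMk A) (pslMk (slUpper 1))) : ∃ x, pslMk A = pslMk (slUpper x) := by
  rw [Commute, SemiconjBy, ← map_mul, ← map_mul] at h
  obtain ⟨e, -, he⟩ := (pslMk_eq_iff _ _).1 h
  rw [Matrix.SpecialLinearGroup.coe_mul, Matrix.SpecialLinearGroup.coe_mul, coe_slUpper] at he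
  have hd := A.2
  rw [Matrix.det_fin_two] at hd
  have h00 := congrFun (congrFun he 0) 0
  have h01 := congrFun (congrFun he 0) 1
  have h10 := congrFun (congrFun he 1) 0
  simp [Matrix.mul_apply, Fin.sum_univ_two] at h00 h01 h10
  by_cases h1 : e = 1
  · subst h1
    have hc : A.1 1 0 = 0 := by linear_combination h00
    have ha : A.1 1 1 = A.1 0 0 := by linear_combination h01
    refine ⟨A.1 0 0 * A.1 0 1, (pslMk_eq_iff _ _).2 ⟨A.1 0 0, ?_, ?_⟩⟩
    · rw [hc, ha] at hd; linear_combination hd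
    · rw [coe_slUpper, Matrix.eta_fin_two A.1]
      ext i j
      fin_cases i <;> fin_cases j <;> simp [hc]
      · rw [hc, ha] at hd; linear_combination -hd
      · rw [hc] at hd; linear_combination -hd
  · have h1' : (e - 1) ≠ 0 := sub_ne_zero.2 h1
    have hc : A.1 1 0 = 0 := mul_left_cancel₀ h1' (by linear_combination -h10)
    have ha : A.1 0 0 = 0 := mul_left_cancel₀ h1' (by linear_combination -h00 + hc)
    rw [ha, hc] at hd
    simp at hd

theorem exists_slLower_of_commute (A : SL(2, K)) {t : K} (ht : t ≠ 0)
    (h : Commute (pslMk A) (pslMk (slLower t))) : ∃ x, pslMk A = pslMk (slLower x) := by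
  rw [Commute, SemiconjBy, ← map_mul, ← map_mul] at h
  obtain ⟨e, -, he⟩ := (pslMk_eq_iff _ _).1 h
  rw [Matrix.SpecialLinearGroup.coe_mul, Matrix.SpecialLinearGroup.coe_mul, coe_slLower] at he
  have hd := A.2
  rw [Matrix.det_fin_two] at hd
  have h00 := congrFun (congrFun he 0) 0
  have h01 := congrFun (congrFun he 0) 1
  have h10 := congrFun (congrFun he 1) 0
  have h11 := congrFun (congrFun he 1) 1
  simp [Matrix.mul_apply, Fin.sum_univ_two] at h00 h01 h10 h11
  by_cases h1 : e = 1
  · subst h1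
    have hb : A.1 0 1 = 0 := mul_left_cancel₀ ht (by linear_combination -h00)
    have ha : A.1 1 1 = A.1 0 0 := mul_left_cancel₀ ht (by linear_combination -h10)
    refine ⟨A.1 0 0 * A.1 1 0, (pslMk_eq_iff _ _).2 ⟨A.1 0 0, ?_, ?_⟩⟩
    · rw [hb, ha] at hd; linear_combination hd
    · rw [coe_slLower, Matrix.eta_fin_two A.1]
      ext i j
      fin_cases i <;> fin_cases j <;> simp [hb]
      · rw [hb, ha] at hd; linear_combination -hd
      · rw [hb] at hd; linear_combination -hd
  · have h1' : (e - 1) ≠ 0 := sub_ne_zero.2 h1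
    have hb : A.1 0 1 = 0 := mul_left_cancel₀ h1' (by linear_combination -h01)
    have ha : A.1 0 0 = 0 := mul_left_cancel₀ h1' (by linear_combination -h00 - e * t * hb)
    rw [ha, hb] at hd
    simp at hd

/-- The word `slUpper x * slLower (-x⁻¹) * slUpper x` is antidiagonal, so it interchanges the two
root subgroups. The factor `x⁻²` on the right encodes part of the multiplication of `K` in group
terms. -/
theorem slUpper_slLower_relation {x : K} (hx : x ≠ 0) (y : K) :
    slUpper x * slLower (-x⁻¹) * slUpper x * slUpper y =
      slLower (-(y * (x⁻¹) ^ 2)) * (slUpper x * slLower (-x⁻¹) * slUpper x) := by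
  apply Subtype.ext
  simp only [Matrix.SpecialLinearGroup.coe_mul, coe_slUpper, coe_slLower]
  ext i j
  fin_cases i <;> fin_cases j <;> simp <;> field_simp <;>
    first | ring1 | exact Or.inl (by ring1) | exact Or.inr (by ring1)

theorem eq_of_slUpper_slLower_relation {X H Y H' : K} (hY : Y ≠ 0)
    (h : pslMk (slUpper X * slLower H * slUpper X * slUpper Y) =
      pslMk (slLower H' * (slUpper X * slLower H * slUpper X))) :
    X * H = -1 ∧ H' * X = H * Y := by
  obtain ⟨e, -, he⟩ := (pslMk_eq_iff _ _).1 h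
  simp only [Matrix.SpecialLinearGroup.coe_mul, coe_slUpper, coe_slLower] at he
  have h00 := congrFun (congrFun he 0) 0
  have h01 := congrFun (congrFun he 0) 1
  have h11 := congrFun (congrFun he 1) 1
  simp [Matrix.mul_apply, Fin.sum_univ_two] at h00 h01 h11
  have hm : 1 + X * H = 0 := by
    by_contra hm
    have he1 : e = 1 := mul_right_cancel₀ hm (by linear_combination -h00)
    subst he1
    have : (1 + X * H) * Y = 0 := by linear_combination -h01
    exact (mul_ne_zero hm hY) this
  have hX : X ≠ 0 := by rintro rfl; simp at hm
  have he1 : e = 1 := mul_right_cancel₀ hX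
    (by linear_combination -h01 + (X - e * X - e * Y) * hm)
  subst he1
  exact ⟨by linear_combination hm, by linear_combination h11 - H' * X * hm⟩

/-- Centralisers of unipotents show that `α` preserves both root subgroups and acts on them by
additive maps `f` and `h`. The antidiagonal relation, transported by `α`, gives `h = f` (so in fact
`t = 1`) and makes `f` a field automorphism. -/
theorem exists_pslFieldAut_of_fix [Finite K] (α : MulAut PSL(2, K)) {t : K} (ht : t ≠ 0)
    (hU : α (pslMk (slUpper 1)) = pslMk (slUpper 1))
    (hL : α (pslMk (slLower 1)) = pslMk (slLower t)) : ∃ σ : K ≃+* K, α = pslFieldAut σ := by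
  have hf : ∀ x, ∃ y, α (pslMk (slUpper x)) = pslMk (slUpper y) := by
    intro x
    obtain ⟨A, hA⟩ := pslMk_surjective (α (pslMk (slUpper x)))
    rw [← hA]
    apply exists_slUpper_of_commute
    rw [hA, ← hU]
    apply Commute.map _ α
    apply Commute.map _ pslMk
    rw [Commute, SemiconjBy, ← slUpper_add, ← slUpper_add, add_comm]
  have hh : ∀ x, ∃ y, α (pslMk (slLower x)) = pslMk (slLower y) := by
    intro x
    obtain ⟨A, hA⟩ := pslMk_surjective (α (pslMk (slLower x)))
    rw [← hA]
    apply exists_slLower_of_commute _ ht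
    rw [hA, ← hL]
    apply Commute.map _ α
    apply Commute.map _ pslMk
    rw [Commute, SemiconjBy, ← slLower_add, ← slLower_add, add_comm]
  choose f hf using hf
  choose h hh using hh
  have f_add : ∀ x y, f (x + y) = f x + f y := fun x y => pslMk_slUpper_injective <| by
    rw [← hf, slUpper_add, slUpper_add, map_mul, map_mul, map_mul, hf, hf]
  have h_add : ∀ x y, h (x + y) = h x + h y := fun x y => pslMk_slLower_injective <| by
    rw [← hh, slLower_add, slLower_add, map_mul, map_mul, map_mul, hh, hh]
  have f_one : f 1 = 1 := pslMk_slUpper_injective <| by rw [← hf, hU]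
  have f_zero : f 0 = 0 := by simpa using f_add 0 0
  have h_zero : h 0 = 0 := by simpa using h_add 0 0
  have f_neg : ∀ x, f (-x) = -f x := fun x => by
    have := f_add x (-x)
    rw [add_neg_cancel, f_zero] at this
    linear_combination -this
  have h_neg : ∀ x, h (-x) = -h x := fun x => by
    have := h_add x (-x)
    rw [add_neg_cancel, h_zero] at this
    linear_combination -this
  have f_inj : ∀ x, x ≠ 0 → f x ≠ 0 := fun x hx h0 => hx <| by
    apply pslMk_slUpper_injective
    apply α.injective
    rw [hf, hf, h0, f_zero]
  have key : ∀ x y, x ≠ 0 → y ≠ 0 →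
      f x * h (-x⁻¹) = -1 ∧ h (-(y * (x⁻¹) ^ 2)) * f x = h (-x⁻¹) * f y := by
    intro x y hx hy
    apply eq_of_slUpper_slLower_relation (f_inj y hy)
    have := congrArg (fun A => α (pslMk A)) (slUpper_slLower_relation hx y)
    simpa only [map_mul, hf, hh] using this
  have h_eq : ∀ x, h x = f x := by
    intro x
    by_cases hx : x = 0
    · rw [hx, h_zero, f_zero]
    · obtain ⟨h1, h2⟩ := key 1 x one_ne_zero hx
      simp only [f_one, inv_one, one_pow, mul_one, one_mul, h_neg] at h1 h2
      linear_combination -h2 - f x * h1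
  have f_sq : ∀ y x, f (y * x ^ 2) = f y * f x ^ 2 := by
    intro y x
    by_cases hx : x = 0
    · subst hx; simp [f_zero]
    by_cases hy : y = 0
    · subst hy; simp [f_zero]
    obtain ⟨h1, h2⟩ := key x⁻¹ y (inv_ne_zero hx) hy
    simp only [inv_inv, h_neg, h_eq] at h1 h2
    linear_combination f (y * x ^ 2) * h1 - f x * h2
  have f_sq' : ∀ x, f (x ^ 2) = f x ^ 2 := fun x => by simpa [f_one] using f_sq 1 x
  -- In characteristic two every `y` is a square and `f_sq` applies; otherwise `f (x ^ 2) = f x ^ 2`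
  -- is polarised.
  have f_mul : ∀ x y, f (x * y) = f x * f y := by
    intro x y
    by_cases h2 : ringChar K = 2
    · obtain ⟨z, rfl⟩ := FiniteField.isSquare_of_char_two h2 y
      rw [← pow_two, f_sq, f_sq']
    · have h2' : (2 : K) ≠ 0 := Ring.two_ne_zero h2
      have e := f_sq' (x + y)
      have : (x + y) ^ 2 = x ^ 2 + y ^ 2 + (x * y + x * y) := by ring
      rw [this, f_add, f_add, f_add, f_add, f_sq', f_sq'] at e
      apply mul_left_cancel₀ h2'
      linear_combination e
  let φ : K →+* K :=
    { toFun := f, map_one' := f_one, map_mul' := f_mul, map_zero' := f_zero, map_add' := f_add }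
  refine ⟨RingEquiv.ofBijective φ (Finite.injective_iff_bijective.1 φ.injective), ?_⟩
  apply MulEquiv.toMonoidHom_injective
  apply psl_hom_ext
  · intro x
    change α (pslMk (slUpper x)) = pslFieldAut _ (pslMk (slUpper x))
    rw [hf, pslFieldAut_pslMk]
    congr 1
    apply Subtype.ext
    ext i j
    rw [slFieldAut_apply, coe_slUpper, coe_slUpper]
    fin_cases i <;> fin_cases j <;> simp [φ, f_one, f_zero]
  · intro x
    change α (pslMk (slLower x)) = pslFieldAut _ (pslMk (slLower x))
    rw [hh, h_eq, pslFieldAut_pslMk]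
    congr 1
    apply Subtype.ext
    ext i j
    rw [slFieldAut_apply, coe_slLower, coe_slLower]
    fin_cases i <;> fin_cases j <;> simp [φ, f_one, f_zero]

/-- Every automorphism of `PSL₂(K)`, for `K` a finite field, is induced by a semilinear map. -/
theorem exists_eq_pslSemi [Finite K] (α : MulAut PSL(2, K)) :
    ∃ (g : GL (Fin 2) K) (σ : K ≃+* K), α = pslSemi g σ := by
  obtain ⟨p, hp⟩ := CharP.exists K
  have : Fact p.Prime := ⟨CharP.char_is_prime K p⟩
  have hUp : ∀ n : ℕ, slUpper (1 : K) ^ n = slUpper (n : K) := by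
    intro n
    induction n with
    | zero => simp [slUpper_zero]
    | succ n ih => rw [pow_succ, ih, ← slUpper_add, Nat.cast_succ]
  have hLp : ∀ n : ℕ, slLower (1 : K) ^ n = slLower (n : K) := by
    intro n
    induction n with
    | zero => simp [slLower_zero]
    | succ n ih => rw [pow_succ, ih, ← slLower_add, Nat.cast_succ]
  obtain ⟨A₀, hA₀⟩ := pslMk_surjective (α (pslMk (slUpper 1)))
  obtain ⟨A, hA, htr⟩ := exists_trace_eq_two (p := p) A₀ (by
    rw [hA₀, ← map_pow, ← map_pow, hUp, CharP.cast_eq_zero, slUpper_zero, map_one, map_one])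
  have hA1 : A ≠ 1 := by
    rintro rfl
    rw [hA₀, map_one, eq_comm, map_eq_one_iff α α.injective, ← map_one pslMk,
      ← slUpper_zero] at hA
    exact one_ne_zero (pslMk_slUpper_injective hA)
  obtain ⟨g, hg⟩ := exists_slConj_slUpper A htr hA1
  set β : MulAut PSL(2, K) := (pslLift K (slConj g))⁻¹ * α with hβ
  have hβα : α = pslLift K (slConj g) * β := by rw [hβ, mul_inv_cancel_left]
  have hβU : β (pslMk (slUpper 1)) = pslMk (slUpper 1) := by
    apply (pslLift K (slConj g)).injective
    rw [← MulAut.mul_apply, ← hβα, pslLift_pslMk, hg, hA, hA₀]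
  obtain ⟨B₀, hB₀⟩ := pslMk_surjective (β (pslMk (slLower 1)))
  obtain ⟨B, hB, htr⟩ := exists_trace_eq_two (p := p) B₀ (by
    rw [hB₀, ← map_pow, ← map_pow, hLp, CharP.cast_eq_zero, slLower_zero, map_one, map_one])
  rw [hB₀] at hB
  have hd := B.2
  rw [Matrix.det_fin_two] at hd
  -- Otherwise `B` would be upper unitriangular and commute with `slUpper 1`, although its preimage
  -- `slLower 1` does not.
  have ht : B.1 1 0 ≠ 0 := by
    intro hc
    have ha : B.1 0 0 = 1 := by
      have : (B.1 0 0 - 1) ^ 2 = 0 := by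
        rw [hc] at hd
        linear_combination B.1 0 0 * htr - hd
      exact sub_eq_zero.1 (pow_eq_zero_iff two_ne_zero |>.1 this)
    have hd1 : B.1 1 1 = 1 := by linear_combination htr - ha
    have hBu : B = slUpper (B.1 0 1) := by
      apply Subtype.ext
      rw [coe_slUpper, Matrix.eta_fin_two B.1, ha, hc, hd1]
      simp
    have hcomm : Commute (pslMk (slLower (1 : K))) (pslMk (slUpper 1)) := by
      have : Commute (β (pslMk (slLower (1 : K)))) (β (pslMk (slUpper 1))) := by
        rw [hβU, ← hB, hBu]
        apply Commute.map _ pslMk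
        rw [Commute, SemiconjBy, ← slUpper_add, ← slUpper_add, add_comm]
      rw [Commute, SemiconjBy, ← map_mul β, ← map_mul β] at this
      exact β.injective this
    obtain ⟨x, hx⟩ := exists_slUpper_of_commute _ hcomm
    exact pslMk_slUpper_ne_slLower one_ne_zero hx
  -- Conjugation by `slUpper z` centralises `slUpper 1`; this `z` makes the upper left entry of `B`
  -- equal to `1`, and trace `2` and determinant `1` then leave a lower unitriangular matrix.
  set z : K := (1 - B.1 0 0) / B.1 1 0 with hz
  set γ : MulAut PSL(2, K) := MulAut.conj (pslMk (slUpper z)) * β with hγ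
  have hγU : γ (pslMk (slUpper 1)) = pslMk (slUpper 1) := by
    rw [hγ, MulAut.mul_apply, hβU, MulAut.conj_apply, ← map_inv, ← map_mul, ← map_mul,
      slUpper_inv, ← slUpper_add, ← slUpper_add]
    congr 2
    ring
  have hγL : γ (pslMk (slLower 1)) = pslMk (slLower (B.1 1 0)) := by
    rw [hγ, MulAut.mul_apply, ← hB, MulAut.conj_apply, ← map_inv, ← map_mul, ← map_mul]
    congr 1
    rw [mul_inv_eq_iff_eq_mul]
    apply Subtype.ext
    simp only [Matrix.SpecialLinearGroup.coe_mul, coe_slUpper, coe_slLower]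
    rw [Matrix.eta_fin_two B.1]
    have hzt : z * B.1 1 0 = 1 - B.1 0 0 := by rw [hz]; field_simp
    ext i j
    fin_cases i <;> fin_cases j <;> simp
    · linear_combination hzt
    · apply mul_right_cancel₀ ht
      linear_combination (B.1 1 1 - 1) * hzt - hd + htr
    · linear_combination htr - hzt
  obtain ⟨σ, hσ⟩ := exists_pslFieldAut_of_fix γ ht hγU hγL
  refine ⟨g * (Matrix.SpecialLinearGroup.toGL (slUpper z))⁻¹, σ, ?_⟩
  have hc : MulAut.conj (pslMk (slUpper z)) =
      pslLift K (slConj (Matrix.SpecialLinearGroup.toGL (slUpper z))) := by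
    ext x
    obtain ⟨A, rfl⟩ := pslMk_surjective x
    rfl
  rw [pslSemi, ← hσ, hγ, hc, map_mul, map_mul, map_inv, map_inv, mul_assoc, inv_mul_cancel_left,
    ← hβα]

end Automorphisms

/-! ### Finite subfields and the involution over a subfield of index two -/

section Subfields

variable {K : Type*} [Field K]

open Polynomial in
/-- A finite subfield is the fixed set of its Frobenius map. -/
theorem Subfield.mem_iff_pow_card_eq (F : Subfield K) [Finite F] (x : K) :
    x ∈ F ↔ x ^ Nat.card F = x := by
  classical
  have := Fintype.ofFinite F
  rw [Nat.card_eq_fintype_card]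
  have hF : ∀ y ∈ F, y ^ Fintype.card F = y := fun y hy =>
    congrArg Subtype.val (FiniteField.pow_card (⟨y, hy⟩ : F))
  refine ⟨hF x, fun hx => by_contra fun hxF => ?_⟩
  set S : Finset K := insert x (Finset.univ.map (Function.Embedding.subtype (· ∈ F))) with hS
  have hcard : S.card = Fintype.card F + 1 := by
    rw [hS, Finset.card_insert_of_notMem, Finset.card_map, Finset.card_univ]
    simpa using hxF
  have h1 : 1 < Fintype.card F := Fintype.one_lt_card
  have hdeg := FiniteField.X_pow_card_sub_X_natDegree_eq K h1
  have hne := FiniteField.X_pow_card_sub_X_ne_zero K h1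
  have hle := card_le_degree_of_subset_roots (R := K) (p := X ^ Fintype.card F - X) (Z := S)
    fun y hy => by
      rw [mem_roots hne, IsRoot, eval_sub, eval_pow, eval_X, sub_eq_zero]
      simp only [hS, Finset.insert_val, Multiset.mem_ndinsert] at hy
      rcases hy with rfl | hy
      · exact hx
      · simp at hy
        exact hF y hy
  omega

theorem Subfield.map_mem_iff (F : Subfield K) [Finite F] (σ : K ≃+* K) (x : K) :
    σ x ∈ F ↔ x ∈ F := by
  rw [F.mem_iff_pow_card_eq, F.mem_iff_pow_card_eq, ← map_pow, σ.injective.eq_iff]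

/-- The involutory automorphism of a finite field over a subfield of index two. -/
theorem Subfield.exists_involution [Finite K] (F : Subfield K)
    (hK : Nat.card K = Nat.card F ^ 2) :
    ∃ τ : K ≃+* K, (∀ x, τ x = x ^ Nat.card F) ∧ (∀ x, τ x = x ↔ x ∈ F) ∧
      (∀ x, τ (τ x) = x) ∧ ∃ x, τ x ≠ x := by
  have := Fintype.ofFinite K
  have := Fintype.ofFinite F
  have hτ : ∀ x, FiniteField.frobeniusAlgEquivOfAlgebraic F K x = x ^ Nat.card F := fun x => by
    rw [Nat.card_eq_fintype_card]; rfl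
  have hfix : ∀ x, FiniteField.frobeniusAlgEquivOfAlgebraic F K x = x ↔ x ∈ F := fun x => by
    rw [hτ, F.mem_iff_pow_card_eq]
  refine ⟨(FiniteField.frobeniusAlgEquivOfAlgebraic F K).toRingEquiv, hτ, hfix, fun x => ?_, ?_⟩
  · change FiniteField.frobeniusAlgEquivOfAlgebraic F K
      (FiniteField.frobeniusAlgEquivOfAlgebraic F K x) = x
    rw [hτ, hτ, ← pow_mul, ← pow_two, ← hK, Nat.card_eq_fintype_card, FiniteField.pow_card]
  · by_contra! h
    have hle : Nat.card K ≤ Nat.card F :=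
      Nat.card_le_card_of_injective (fun x : K => (⟨x, (hfix x).1 (h x)⟩ : F))
        fun x y hxy => congrArg Subtype.val hxy
    have : 1 < Nat.card F := Finite.one_lt_card
    nlinarith

theorem Subfield.mem_of_two_mul_mem_of_sq_mem (F : Subfield K) [Finite F] {e : K}
    (h2 : 2 * e ∈ F) (hsq : e ^ 2 ∈ F) : e ∈ F := by
  by_cases h : (2 : K) = 0
  · have hF : ringChar F = 2 := by
      have : CharP F 2 := by
        apply CharTwo.of_one_ne_zero_of_two_eq_zero one_ne_zero
        exact Subtype.ext h
      exact ringChar.eq_iff.2 this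
    obtain ⟨⟨d, hd⟩, hd2⟩ := FiniteField.isSquare_of_char_two hF (⟨e ^ 2, hsq⟩ : F)
    have hd2 : e ^ 2 = d * d := congrArg Subtype.val hd2
    have : (e - d) ^ 2 = 0 := by linear_combination hd2 + (d ^ 2 - e * d) * h
    rw [sub_eq_zero.1 (pow_eq_zero_iff two_ne_zero |>.1 this)]
    exact hd
  · have h2F : (2 : K) ∈ F := by exact_mod_cast natCast_mem F 2
    have := F.div_mem h2 h2F
    rwa [mul_div_cancel_left₀ _ h] at this

end Subfields

/-! ### Forms of `K²` up to scalars and their stabilisers -/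

section ScaledEntries

variable {K : Type*} [Field K]

/-- The matrix `M` is, up to a nonzero scalar, a matrix over the subfield `F`. -/
def HasEntriesUpToScalar (F : Subfield K) (M : Matrix (Fin 2) (Fin 2) K) : Prop :=
  ∃ c : K, c ≠ 0 ∧ ∀ i j, c * M i j ∈ F

namespace HasEntriesUpToScalar

variable {F : Subfield K} {M N : Matrix (Fin 2) (Fin 2) K}

theorem of_mem (h : ∀ i j, M i j ∈ F) : HasEntriesUpToScalar F M :=
  ⟨1, one_ne_zero, by simpa using h⟩

theorem mul (hM : HasEntriesUpToScalar F M) (hN : HasEntriesUpToScalar F N) :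
    HasEntriesUpToScalar F (M * N) := by
  obtain ⟨c, hc, hM⟩ := hM
  obtain ⟨d, hd, hN⟩ := hN
  refine ⟨c * d, mul_ne_zero hc hd, fun i j => ?_⟩
  have : c * d * (M * N) i j = c * M i 0 * (d * N 0 j) + c * M i 1 * (d * N 1 j) := by
    rw [Matrix.mul_apply, Fin.sum_univ_two]; ring
  rw [this]
  exact F.add_mem (F.mul_mem (hM _ _) (hN _ _)) (F.mul_mem (hM _ _) (hN _ _))

theorem smul_iff {e : K} (he : e ≠ 0) :
    HasEntriesUpToScalar F (e • M) ↔ HasEntriesUpToScalar F M := by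
  constructor
  · rintro ⟨c, hc, h⟩
    exact ⟨c * e, mul_ne_zero hc he, fun i j => by simpa [mul_assoc] using h i j⟩
  · rintro ⟨c, hc, h⟩
    exact ⟨c * e⁻¹, mul_ne_zero hc (inv_ne_zero he), fun i j => by
      simpa [mul_assoc, inv_mul_cancel_left₀ he] using h i j⟩

theorem adjugate (hM : HasEntriesUpToScalar F M) : HasEntriesUpToScalar F M.adjugate := by
  obtain ⟨c, hc, hM⟩ := hM
  refine ⟨c, hc, fun i j => ?_⟩
  rw [Matrix.adjugate_fin_two]
  fin_cases i <;> fin_cases j <;> simp [hM]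

theorem inv (g : GL (Fin 2) K) (hg : HasEntriesUpToScalar F g.1) :
    HasEntriesUpToScalar F (g⁻¹).1 := by
  have hd : (g.1.det)⁻¹ ≠ 0 := inv_ne_zero (Matrix.GeneralLinearGroup.det_ne_zero g)
  have : (g⁻¹).1 = (g.1.det)⁻¹ • g.1.adjugate := by
    rw [Matrix.GeneralLinearGroup.coe_inv, Matrix.inv_def, Ring.inverse_eq_inv']
  rw [this, smul_iff hd]
  exact hg.adjugate

end HasEntriesUpToScalar

theorem mem_subfieldGL_iff (F : Subfield K) (g M : GL (Fin 2) K) :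
    M ∈ subfieldGL F g ↔ HasEntriesUpToScalar F (g⁻¹ * M * g).1 := by
  rw [subfieldGL, Subgroup.mem_sup_of_normal_left]
  constructor
  · rintro ⟨z, hz, _, ⟨_, ⟨h, rfl⟩, rfl⟩, rfl⟩
    have hz' := Subgroup.mem_center_iff.1 hz
    obtain ⟨c, hc⟩ := Matrix.GeneralLinearGroup.mem_center_iff_val_mem_range_scalar.1 hz
    have hc0 : c ≠ 0 := by
      rintro rfl
      have := Matrix.GeneralLinearGroup.det_ne_zero z
      simp [← hc] at this
    have : g⁻¹ * (z * (MulAut.conj g) (Matrix.GeneralLinearGroup.map F.subtype h)) * g =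
        z * Matrix.GeneralLinearGroup.map F.subtype h := by
      rw [MulAut.conj_apply, ← mul_assoc, hz' g⁻¹]; group
    change HasEntriesUpToScalar F
      (g⁻¹ * (z * (MulAut.conj g) (Matrix.GeneralLinearGroup.map F.subtype h)) * g).1
    rw [this, Units.val_mul, ← hc, Matrix.scalar_apply, ← Matrix.smul_eq_diagonal_mul,
      HasEntriesUpToScalar.smul_iff hc0]
    exact HasEntriesUpToScalar.of_mem fun i j => (h.1 i j).2
  · rintro ⟨c, hc, h⟩
    let N : Matrix (Fin 2) (Fin 2) F := Matrix.of fun i j => ⟨_, h i j⟩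
    have hN : N.map F.subtype = c • (g⁻¹ * M * g).1 := by ext i j; rfl
    have hdet : N.det ≠ 0 := by
      intro h0
      have h1 : (N.map F.subtype).det = 0 := by
        rw [← RingHom.mapMatrix_apply, ← RingHom.map_det, h0, map_zero]
      rw [hN, Matrix.det_smul] at h1
      exact mul_ne_zero (pow_ne_zero _ hc) (Matrix.GeneralLinearGroup.det_ne_zero _) h1
    let n : GL (Fin 2) F := Matrix.GeneralLinearGroup.mkOfDetNeZero N hdet
    let z : GL (Fin 2) K := Matrix.GeneralLinearGroup.scalar (Fin 2) (Units.mk0 c hc)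
    have hz : z ∈ Subgroup.center (GL (Fin 2) K) :=
      Matrix.GeneralLinearGroup.mem_center_iff_val_mem_range_scalar.2 ⟨c, rfl⟩
    have hn : Matrix.GeneralLinearGroup.map F.subtype n = z * (g⁻¹ * M * g) := by
      apply Units.ext
      rw [Units.val_mul]
      change N.map F.subtype = Matrix.scalar (Fin 2) c * _
      rw [hN, Matrix.scalar_apply, ← Matrix.smul_eq_diagonal_mul]
    refine ⟨z⁻¹, Subgroup.inv_mem _ hz, _, ⟨_, ⟨n, rfl⟩, rfl⟩, ?_⟩
    change z⁻¹ * (MulAut.conj g) (Matrix.GeneralLinearGroup.map F.subtype n) = M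
    rw [hn, MulAut.conj_apply, ← mul_assoc, ← mul_assoc, ← mul_assoc,
      Subgroup.mem_center_iff.1 (Subgroup.inv_mem _ hz) g |>.symm]
    group

theorem pslMk_mem_subfieldPSL_iff (F : Subfield K) (g : GL (Fin 2) K) (A : SL(2, K)) :
    pslMk A ∈ subfieldPSL F g ↔
      HasEntriesUpToScalar F (g⁻¹ * Matrix.SpecialLinearGroup.toGL A * g).1 := by
  rw [← mem_subfieldGL_iff]
  constructor
  · rintro ⟨B, hB, hBA⟩
    obtain ⟨e, he, h⟩ := (pslMk_eq_iff _ _).1 hBA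
    rw [SetLike.mem_coe, Subgroup.mem_comap, mem_subfieldGL_iff] at hB
    have he0 : e ≠ 0 := by rintro rfl; simp at he
    rw [mem_subfieldGL_iff]
    have : (g⁻¹ * Matrix.SpecialLinearGroup.toGL A * g).1 =
        e • (g⁻¹ * Matrix.SpecialLinearGroup.toGL B * g).1 := by
      simp only [Units.val_mul]
      change (g⁻¹).1 * A.1 * g.1 = e • ((g⁻¹).1 * B.1 * g.1)
      rw [h, Matrix.mul_smul, Matrix.smul_mul]
    rwa [this, HasEntriesUpToScalar.smul_iff he0]
  · exact fun h => ⟨A, h, rfl⟩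

/-- Up to `1` and signs, the entries of the two conjugates are products of two entries of `k` over
`det k`. Once the scalars are known to lie in `F`, so do all such products, and `k` is scaled by one
of its own nonzero entries over `det k`. -/
theorem HasEntriesUpToScalar.of_conj_unitriangular [Finite K] {F : Subfield K}
    (k : GL (Fin 2) K)
    (hU : HasEntriesUpToScalar F (k⁻¹ * Matrix.SpecialLinearGroup.toGL (slUpper 1) * k).1)
    (hL : HasEntriesUpToScalar F (k⁻¹ * Matrix.SpecialLinearGroup.toGL (slLower 1) * k).1) :
    HasEntriesUpToScalar F k.1 := by
  obtain ⟨u, hu, hU⟩ := hU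
  obtain ⟨v, hv, hL⟩ := hL
  have hΔ := Matrix.GeneralLinearGroup.det_ne_zero k
  have hinv : (k⁻¹).1 = (k.1.det)⁻¹ • k.1.adjugate := by
    rw [Matrix.GeneralLinearGroup.coe_inv, Matrix.inv_def, Ring.inverse_eq_inv']
  have hk := Matrix.eta_fin_two k.1
  generalize ha : k.1 0 0 = a at hk
  generalize hb : k.1 0 1 = b at hk
  generalize hc : k.1 1 0 = c at hk
  generalize hd : k.1 1 1 = d at hk
  have hΔ' : k.1.det = a * d - b * c := by rw [hk, Matrix.det_fin_two_of]
  rw [hΔ'] at hinv hΔ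
  set D := a * d - b * c with hD
  have e1 : (k⁻¹ * Matrix.SpecialLinearGroup.toGL (slUpper 1) * k).1 =
      !![1 + d * c / D, d * d / D; -(c * c / D), 1 - c * d / D] := by
    rw [Units.val_mul, Units.val_mul, hinv, hk, Matrix.SpecialLinearGroup.coe_GL_coe_matrix,
      coe_slUpper, Matrix.adjugate_fin_two_of]
    ext i j
    fin_cases i <;> fin_cases j <;> simp <;> field_simp <;> ring
  have e2 : (k⁻¹ * Matrix.SpecialLinearGroup.toGL (slLower 1) * k).1 =
      !![1 - b * a / D, -(b * b / D); a * a / D, 1 + a * b / D] := by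
    rw [Units.val_mul, Units.val_mul, hinv, hk, Matrix.SpecialLinearGroup.coe_GL_coe_matrix,
      coe_slLower, Matrix.adjugate_fin_two_of]
    ext i j
    fin_cases i <;> fin_cases j <;> simp <;> field_simp <;> ring
  rw [e1] at hU
  rw [e2] at hL
  have u00 := hU 0 0
  have u01 := hU 0 1
  have u10 := hU 1 0
  have u11 := hU 1 1
  have v00 := hL 0 0
  have v01 := hL 0 1
  have v10 := hL 1 0
  have v11 := hL 1 1
  simp only [Matrix.of_apply, Matrix.cons_val', Matrix.cons_val_zero, Matrix.cons_val_one,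
    Matrix.cons_val_fin_one] at u00 u01 u10 u11 v00 v01 v10 v11
  -- A scaled unipotent matrix has trace `2 * u` and determinant `u ^ 2`, both in `F`.
  have huF : u ∈ F := by
    apply F.mem_of_two_mul_mem_of_sq_mem
    · convert F.add_mem u00 u11 using 1; ring
    · convert F.sub_mem (F.mul_mem u00 u11) (F.mul_mem u01 u10) using 1; ring
  have hvF : v ∈ F := by
    apply F.mem_of_two_mul_mem_of_sq_mem
    · convert F.add_mem v00 v11 using 1; ring
    · convert F.sub_mem (F.mul_mem v00 v11) (F.mul_mem v01 v10) using 1; ring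
  have cd : c * d / D ∈ F := by
    convert F.sub_mem F.one_mem (F.div_mem u11 huF) using 1; field_simp; ring
  have dd : d * d / D ∈ F := by
    convert F.div_mem u01 huF using 1; field_simp
  have cc : c * c / D ∈ F := by
    convert F.neg_mem (F.div_mem u10 huF) using 1; field_simp
  have ab : a * b / D ∈ F := by
    convert F.sub_mem (F.div_mem v11 hvF) F.one_mem using 1; field_simp; ring
  have bb : b * b / D ∈ F := by
    convert F.neg_mem (F.div_mem v01 hvF) using 1; field_simp
  have aa : a * a / D ∈ F := by
    convert F.div_mem v10 hvF using 1; field_simp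
  have ad : a * d / D ∈ F := by
    convert F.sub_mem (F.mul_mem dd aa) (F.mul_mem cd ab) using 1
    field_simp; rw [hD]; ring
  have ac : a * c / D ∈ F := by
    convert F.sub_mem (F.mul_mem cd aa) (F.mul_mem cc ab) using 1
    field_simp; rw [hD]; ring
  have bc : b * c / D ∈ F := by
    convert F.sub_mem (F.mul_mem cd ab) (F.mul_mem cc bb) using 1
    field_simp; rw [hD]; ring
  by_cases ha0 : a = 0
  · have hc0 : c ≠ 0 := by rintro rfl; simp [hD, ha0] at hΔ
    refine ⟨c / D, div_ne_zero hc0 hΔ, fun i j => ?_⟩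
    rw [hk]
    fin_cases i <;> fin_cases j <;> simp
    · convert ac using 1; ring
    · convert bc using 1; ring
    · convert cc using 1; ring
    · convert cd using 1; ring
  · refine ⟨a / D, div_ne_zero ha0 hΔ, fun i j => ?_⟩
    rw [hk]
    fin_cases i <;> fin_cases j <;> simp
    · convert aa using 1; ring
    · convert ab using 1; ring
    · convert ac using 1; ring
    · convert ad using 1; ring

/-- A subfield subgroup determines its form: if the groups agree, conjugation by `g⁻¹ * h` keeps the
standard unipotents over `F` up to scalars, and these detect `g⁻¹ * h` itself. -/
theorem subfieldPSL_eq_iff [Finite K] (F : Subfield K) (g h : GL (Fin 2) K) :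
    subfieldPSL F g = subfieldPSL F h ↔ HasEntriesUpToScalar F (g⁻¹ * h).1 := by
  constructor
  · intro heq
    have key : ∀ A : SL(2, K), (∀ i j, A.1 i j ∈ F) → HasEntriesUpToScalar F
        ((g⁻¹ * h)⁻¹ * Matrix.SpecialLinearGroup.toGL A * (g⁻¹ * h)).1 := by
      intro A hA
      have h1 : pslMk (slConj g A) ∈ subfieldPSL F g := by
        rw [pslMk_mem_subfieldPSL_iff, toGL_slConj]
        have : g⁻¹ * (g * Matrix.SpecialLinearGroup.toGL A * g⁻¹) * g =
          Matrix.SpecialLinearGroup.toGL A := by group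
        rw [this]
        exact HasEntriesUpToScalar.of_mem hA
      rw [heq, pslMk_mem_subfieldPSL_iff, toGL_slConj] at h1
      have : (g⁻¹ * h)⁻¹ * Matrix.SpecialLinearGroup.toGL A * (g⁻¹ * h) =
        h⁻¹ * (g * Matrix.SpecialLinearGroup.toGL A * g⁻¹) * h := by group
      rwa [this]
    apply HasEntriesUpToScalar.of_conj_unitriangular
    · apply key
      intro i j
      rw [coe_slUpper]
      fin_cases i <;> fin_cases j <;> simp
    · apply key
      intro i j
      rw [coe_slLower]
      fin_cases i <;> fin_cases j <;> simp
  · intro hgh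
    have key : ∀ g h : GL (Fin 2) K, HasEntriesUpToScalar F (g⁻¹ * h).1 →
        subfieldPSL F g ≤ subfieldPSL F h := by
      intro g h hgh x hx
      obtain ⟨A, rfl⟩ := pslMk_surjective x
      rw [pslMk_mem_subfieldPSL_iff] at hx ⊢
      have : h⁻¹ * Matrix.SpecialLinearGroup.toGL A * h = (g⁻¹ * h)⁻¹ *
        (g⁻¹ * Matrix.SpecialLinearGroup.toGL A * g) * (g⁻¹ * h) := by group
      rw [this, Units.val_mul, Units.val_mul]
      exact ((HasEntriesUpToScalar.inv _ hgh).mul hx).mul hgh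
    refine le_antisymm (key g h hgh) (key h g ?_)
    have : h⁻¹ * g = (g⁻¹ * h)⁻¹ := by group
    rw [this]
    exact HasEntriesUpToScalar.inv _ hgh

theorem HasEntriesUpToScalar.glMap_iff [Finite K] {F : Subfield K} (σ : K ≃+* K)
    (g : GL (Fin 2) K) :
    HasEntriesUpToScalar F (glMap σ g).1 ↔ HasEntriesUpToScalar F g.1 := by
  constructor
  · rintro ⟨c, hc, h⟩
    refine ⟨σ.symm c, by simpa using hc, fun i j => ?_⟩
    rw [← F.map_mem_iff σ, map_mul, σ.apply_symm_apply]
    exact h i j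
  · rintro ⟨c, hc, h⟩
    refine ⟨σ c, by simpa using hc, fun i j => ?_⟩
    change σ c * σ (g.1 i j) ∈ F
    rw [← map_mul, F.map_mem_iff]
    exact h i j

theorem map_pslSemi_subfieldPSL [Finite K] (F : Subfield K) (h : GL (Fin 2) K) (σ : K ≃+* K)
    (g : GL (Fin 2) K) :
    (subfieldPSL F g).map (pslSemi h σ).toMonoidHom = subfieldPSL F (h * glMap σ g) := by
  have key : ∀ x, pslSemi h σ x ∈ subfieldPSL F (h * glMap σ g) ↔ x ∈ subfieldPSL F g := by
    intro x
    obtain ⟨A, rfl⟩ := pslMk_surjective x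
    rw [pslSemi_pslMk, pslMk_mem_subfieldPSL_iff, pslMk_mem_subfieldPSL_iff, toGL_slConj]
    have hA : Matrix.SpecialLinearGroup.toGL (slFieldAut σ A) =
      glMap σ (Matrix.SpecialLinearGroup.toGL A) := Units.ext rfl
    rw [hA]
    have : (h * glMap σ g)⁻¹ * (h * glMap σ (Matrix.SpecialLinearGroup.toGL A) * h⁻¹) *
        (h * glMap σ g) = glMap σ (g⁻¹ * Matrix.SpecialLinearGroup.toGL A * g) := by
      simp only [map_mul, map_inv]; group
    rw [this, HasEntriesUpToScalar.glMap_iff]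
  ext y
  obtain ⟨x, rfl⟩ := (pslSemi h σ).surjective y
  rw [key]
  constructor
  · rintro ⟨z, hz, hzx⟩
    rwa [← (pslSemi h σ).injective hzx]
  · exact fun hx => ⟨x, hx, rfl⟩

/-- A semilinear automorphism normalises a subfield subgroup iff it fixes the corresponding form
up to scalars. -/
theorem map_pslSemi_subfieldPSL_eq_iff [Finite K] (F : Subfield K) (h : GL (Fin 2) K)
    (σ : K ≃+* K) (g : GL (Fin 2) K) :
    (subfieldPSL F g).map (pslSemi h σ).toMonoidHom = subfieldPSL F g ↔
      HasEntriesUpToScalar F (g⁻¹ * h * glMap σ g).1 := by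
  rw [map_pslSemi_subfieldPSL, eq_comm, subfieldPSL_eq_iff, mul_assoc]

end ScaledEntries

/-! ### Semilinear maps preserving several sublines -/

section Triangles

variable {K : Type*} [Field K] {F : Subfield K}

theorem HasEntriesUpToScalar.div_mem {M : Matrix (Fin 2) (Fin 2) K}
    (h : HasEntriesUpToScalar F M) (i j k l : Fin 2) : M i j / M k l ∈ F := by
  obtain ⟨c, hc, h⟩ := h
  rw [← mul_div_mul_left _ _ hc]
  exact F.div_mem (h i j) (h k l)

theorem Subfield.eq_zero_of_mem_of_mul_mem {x y : K} (hx : x ∈ F) (hy : y ∉ F)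
    (hxy : x * y ∈ F) : x = 0 := by
  by_contra h
  apply hy
  have := F.div_mem hxy hx
  rwa [mul_div_cancel_left₀ _ h] at this

theorem Subfield.eq_zero_of_mem_of_div_mem {x y : K} (hx : x ∈ F) (hy : y ∉ F)
    (hxy : x / y ∈ F) : x = 0 := by
  by_contra h
  apply hy
  have := F.div_mem hx hxy
  rwa [div_div_cancel₀ h] at this

theorem HasEntriesUpToScalar.conj_iff_adjugate (g h k : GL (Fin 2) K) :
    HasEntriesUpToScalar F (g⁻¹ * h * k).1 ↔
      HasEntriesUpToScalar F (g.1.adjugate * h.1 * k.1) := by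
  have hd : (g.1.det)⁻¹ ≠ 0 := inv_ne_zero (Matrix.GeneralLinearGroup.det_ne_zero g)
  have : (g⁻¹).1 = (g.1.det)⁻¹ • g.1.adjugate := by
    rw [Matrix.GeneralLinearGroup.coe_inv, Matrix.inv_def, Ring.inverse_eq_inv']
  rw [Units.val_mul, Units.val_mul, this, Matrix.smul_mul, Matrix.smul_mul,
    HasEntriesUpToScalar.smul_iff hd]

/-- The matrix of the affine map `x ↦ b x + c`. -/
noncomputable def glAffine (b c : K) (hb : b ≠ 0) : GL (Fin 2) K :=
  Matrix.GeneralLinearGroup.mkOfDetNeZero !![b, c; 0, 1] (by simpa [Matrix.det_fin_two])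

theorem coe_glAffine (b c : K) (hb : b ≠ 0) : (glAffine b c hb).1 = !![b, c; 0, 1] := rfl

theorem coe_glMap_glAffine (σ : K ≃+* K) (b c : K) (hb : b ≠ 0) :
    (glMap σ (glAffine b c hb)).1 = !![σ b, σ c; 0, 1] := by
  ext i j
  change σ ((glAffine b c hb).1 i j) = _
  rw [coe_glAffine]
  fin_cases i <;> fin_cases j <;> simp

theorem glAffine_conj_entries (σ : K ≃+* K) {b c p q r s : K} (hb : b ≠ 0) {h : GL (Fin 2) K}
    (hh : h.1 = !![p, q; r, s])
    (H : HasEntriesUpToScalar F ((glAffine b c hb)⁻¹ * h * glMap σ (glAffine b c hb)).1) :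
    HasEntriesUpToScalar F !![(p - c * r) * σ b, (p - c * r) * σ c + (q - c * s);
      b * r * σ b, b * (r * σ c + s)] := by
  rw [HasEntriesUpToScalar.conj_iff_adjugate, coe_glMap_glAffine, coe_glAffine, hh,
    Matrix.adjugate_fin_two_of] at H
  convert H using 1
  ext i j
  fin_cases i <;> fin_cases j <;> simp <;> first | ring1 | exact Or.inl (by ring1)

/-- A semilinear map preserving the sublines through `0` and `∞` in the directions `1` and `a`
fixes or swaps these two points. -/
theorem diagonal_or_antidiagonal_of_two_lines [Finite K] (σ : K ≃+* K) {a p q r s : K}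
    (haF : a ∉ F) (hdet : p * s - q * r ≠ 0)
    (h1 : HasEntriesUpToScalar F !![p, q; r, s])
    (h2 : HasEntriesUpToScalar F !![p * σ a, q; a * r * σ a, a * s]) :
    (q = 0 ∧ r = 0 ∧ s ≠ 0 ∧ p ≠ 0 ∧ p / s ∈ F ∧ σ a / a ∈ F) ∨
      (p = 0 ∧ s = 0 ∧ r ≠ 0) := by
  have ha : a ≠ 0 := fun h => haF (h ▸ F.zero_mem)
  have hbF : σ a ∉ F := by rwa [F.map_mem_iff]
  have hb : σ a ≠ 0 := fun h => hbF (h ▸ F.zero_mem)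
  -- Ratios of entries of either matrix lie in `F`, while corresponding ratios differ by the factor
  -- `a` or `σ a` outside `F`; such ratios must vanish.
  by_cases hs : s = 0
  · right
    have hr : r ≠ 0 := by rintro rfl; simp [hs] at hdet
    have u1 : p / r ∈ F := h1.div_mem 0 0 1 0
    have u2 : p * σ a / (a * r * σ a) ∈ F := h2.div_mem 0 0 1 0
    have : p / r = 0 := Subfield.eq_zero_of_mem_of_div_mem u1 haF (by
      convert u2 using 1; field_simp)
    exact ⟨(div_eq_zero_iff.1 this).resolve_right hr, hs, hr⟩
  · left
    have u1 : q / s ∈ F := h1.div_mem 0 1 1 1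
    have u2 : q / (a * s) ∈ F := h2.div_mem 0 1 1 1
    have u3 : r / s ∈ F := h1.div_mem 1 0 1 1
    have u4 : a * r * σ a / (a * s) ∈ F := h2.div_mem 1 0 1 1
    have u5 : p / s ∈ F := h1.div_mem 0 0 1 1
    have u6 : p * σ a / (a * s) ∈ F := h2.div_mem 0 0 1 1
    have hq : q / s = 0 := Subfield.eq_zero_of_mem_of_div_mem u1 haF (by
      convert u2 using 1; field_simp)
    have hr : r / s = 0 := Subfield.eq_zero_of_mem_of_mul_mem u3 hbF (by
      convert u4 using 1; field_simp)
    have hq := (div_eq_zero_iff.1 hq).resolve_right hs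
    have hr := (div_eq_zero_iff.1 hr).resolve_right hs
    have hp : p ≠ 0 := by rintro rfl; simp [hq] at hdet
    refine ⟨hq, hr, hs, hp, u5, ?_⟩
    convert F.div_mem u6 u5 using 1
    field_simp

/-- A semilinear map preserving the three sublines of a triangle `0, 1, a` is scalar and fixes
`a`. -/
theorem scalar_of_triangle [Finite K] (σ : K ≃+* K) {a p q r s : K} (haF : a ∉ F)
    (ha : a ≠ 0) (ha1 : 1 - a ≠ 0) {h : GL (Fin 2) K} (hh : h.1 = !![p, q; r, s])
    (H1 : HasEntriesUpToScalar F h.1)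
    (H2 : HasEntriesUpToScalar F ((glAffine a 0 ha)⁻¹ * h * glMap σ (glAffine a 0 ha)).1)
    (H3 : HasEntriesUpToScalar F
      ((glAffine (1 - a) 1 ha1)⁻¹ * h * glMap σ (glAffine (1 - a) 1 ha1)).1) :
    q = 0 ∧ r = 0 ∧ p = s ∧ σ a = a := by
  have hdet : p * s - q * r ≠ 0 := by
    have := Matrix.GeneralLinearGroup.det_ne_zero h
    rwa [hh, Matrix.det_fin_two_of] at this
  have h1F : ∀ x : K, x ∉ F → 1 - x ∉ F := fun x hx hx1 => hx <| by
    simpa using F.sub_mem F.one_mem hx1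
  have hbF : σ a ∉ F := by rwa [F.map_mem_iff]
  have hb1 : 1 - σ a ≠ 0 := fun h => h1F _ hbF (h ▸ F.zero_mem)
  have h2 := glAffine_conj_entries σ ha hh H2
  -- The map `x ↦ (1 - a) x + 1` sends `0` to `1` and `-1` to `a`, so this is the side of the
  -- triangle through `1` and `a`.
  have h3 := glAffine_conj_entries σ ha1 hh H3
  rw [hh] at H1
  simp only [map_zero, zero_mul, sub_zero, mul_zero, zero_add, map_one, map_sub, one_mul,
    mul_one] at h2 h3
  rcases diagonal_or_antidiagonal_of_two_lines σ haF hdet H1 h2 with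
    ⟨rfl, rfl, hs, hp, hps, hc⟩ | ⟨rfl, rfl, hr⟩
  · simp only [sub_zero, zero_sub, zero_add, mul_zero, zero_mul] at h3
    have v1 : (p + -s) / ((1 - a) * s) ∈ F := h3.div_mem 0 1 1 1
    have v2 : p * (1 - σ a) / ((1 - a) * s) ∈ F := h3.div_mem 0 0 1 1
    have hps1 : p / s - 1 = 0 :=
      Subfield.eq_zero_of_mem_of_div_mem (F.sub_mem hps F.one_mem) (h1F a haF) (by
        convert v1 using 1; field_simp; ring)
    have hps2 : p = s := by
      rw [sub_eq_zero, div_eq_one_iff_eq hs] at hps1; exact hps1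
    refine ⟨rfl, rfl, hps2, ?_⟩
    subst hps2
    have v3 : (1 - σ a) / (1 - a) ∈ F := by
      convert v2 using 1; field_simp
    set e := (1 - σ a) / (1 - a) with he
    set c := σ a / a with hc'
    have e1 : e * (1 - a) = 1 - σ a := by rw [he]; field_simp
    have e2 : c * a = σ a := by rw [hc']; field_simp
    -- As `e` and `c` lie in `F` and `a` does not, this forces `e = c = 1`, hence `σ a = a`.
    have hec : (e - c) * a = e - 1 := by linear_combination -e1 - e2
    have hec0 : e - c = 0 := Subfield.eq_zero_of_mem_of_mul_mem (F.sub_mem v3 hc) haF (by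
      rw [hec]; exact F.sub_mem v3 F.one_mem)
    rw [hec0, zero_mul] at hec
    linear_combination -e2 - a * hec - a * hec0
  · exfalso
    -- A swap of `0` and `∞` is excluded by the third side: this ratio is `-(1 - a)`.
    have v1 := h3.div_mem 1 0 0 0
    simp only [Matrix.of_apply, Matrix.cons_val', Matrix.cons_val_zero, Matrix.cons_val_one,
      Matrix.cons_val_fin_one] at v1
    apply h1F a haF
    convert F.neg_mem v1 using 1
    field_simp
    ring

theorem scalar_of_two_parallel_lines [Finite K] {a p q r s : K} (haF : a ∉ F)
    (ha : a ≠ 0) {h : GL (Fin 2) K} (hh : h.1 = !![p, q; r, s])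
    (H1 : HasEntriesUpToScalar F h.1)
    (H2 : HasEntriesUpToScalar F ((glAffine a 0 ha)⁻¹ * h * glMap 1 (glAffine a 0 ha)).1)
    (H3 : HasEntriesUpToScalar F
      ((glAffine 1 a one_ne_zero)⁻¹ * h * glMap 1 (glAffine 1 a one_ne_zero)).1) :
    q = 0 ∧ r = 0 ∧ p = s := by
  have hdet : p * s - q * r ≠ 0 := by
    have := Matrix.GeneralLinearGroup.det_ne_zero h
    rwa [hh, Matrix.det_fin_two_of] at this
  have h2 := glAffine_conj_entries 1 ha hh H2
  have h3 := glAffine_conj_entries 1 one_ne_zero hh H3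
  rw [hh] at H1
  simp only [map_zero, zero_mul, sub_zero, mul_zero, zero_add, map_one, one_mul,
    mul_one, RingAut.one_apply] at h2 h3
  rcases diagonal_or_antidiagonal_of_two_lines 1 haF hdet H1 h2 with
    ⟨rfl, rfl, hs, hp, hps, hc⟩ | ⟨rfl, rfl, hr⟩
  · simp only [sub_zero, zero_sub, zero_add, mul_zero, zero_mul] at h3
    have v1 : (p * a + -(a * s)) / s ∈ F := h3.div_mem 0 1 1 1
    have hps1 : p / s - 1 = 0 :=
      Subfield.eq_zero_of_mem_of_mul_mem (F.sub_mem hps F.one_mem) haF (by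
        convert v1 using 1; field_simp; ring)
    rw [sub_eq_zero, div_eq_one_iff_eq hs] at hps1
    exact ⟨rfl, rfl, hps1⟩
  · exfalso
    have v1 := h3.div_mem 0 0 1 0
    simp only [Matrix.of_apply, Matrix.cons_val', Matrix.cons_val_zero, Matrix.cons_val_one,
      Matrix.cons_val_fin_one] at v1
    apply haF
    convert F.neg_mem v1 using 1
    field_simp
    ring

theorem pslSemi_eq_one_of_scalar {h : GL (Fin 2) K} {p : K} (hh : h.1 = !![p, 0; 0, p]) :
    pslSemi h 1 = 1 := by
  ext x
  obtain ⟨A, rfl⟩ := pslMk_surjective x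
  rw [pslSemi_pslMk, MulAut.one_apply]
  congr 1
  rw [slConj_eq_iff, hh]
  change _ * A.1 = A.1 * _
  rw [Matrix.eta_fin_two A.1]
  ext i j
  fin_cases i <;> fin_cases j <;> simp [mul_comm]

end Triangles

/-! ### Squares in `K` with trivial stabiliser in `Aut(K)` -/

section FieldElements

variable {K : Type*} [Field K] [Finite K]

/-- In odd characteristic, `(q₀² - 1) / 2` is a multiple of `q₀ - 1`, so Euler's criterion holds for
every nonzero element of `F`. -/
theorem Subfield.isSquare_of_mem (F : Subfield K) (hK : Nat.card K = Nat.card F ^ 2) {x : K}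
    (hx : x ∈ F) : IsSquare x := by
  by_cases h2 : ringChar K = 2
  · exact FiniteField.isSquare_of_char_two h2 x
  by_cases hx0 : x = 0
  · exact ⟨0, by simp [hx0]⟩
  have := Fintype.ofFinite K
  have := Fintype.ofFinite F
  rw [FiniteField.isSquare_iff h2 hx0]
  have hodd : Fintype.card K % 2 = 1 := FiniteField.odd_card_of_char_ne_two h2
  rw [← Nat.card_eq_fintype_card, hK] at hodd ⊢
  have hqodd : Nat.card F % 2 = 1 := by
    rcases Nat.mod_two_eq_zero_or_one (Nat.card F) with h | h
    · rw [Nat.pow_mod, h] at hodd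
      simp at hodd
    · exact h
  obtain ⟨m, hm⟩ : ∃ m, Nat.card F = 2 * m + 1 := ⟨Nat.card F / 2, by omega⟩
  have hpow : x ^ (2 * m) = 1 := by
    have := (F.mem_iff_pow_card_eq x).1 hx
    rw [hm, pow_succ] at this
    exact mul_right_cancel₀ hx0 (by rw [this, one_mul])
  have : Nat.card F ^ 2 / 2 = 2 * m * (m + 1) := by
    rw [hm]
    have : (2 * m + 1) ^ 2 = 2 * (2 * m * (m + 1)) + 1 := by ring
    omega
  rw [this, pow_mul, hpow, one_pow]

open Polynomial in
theorem card_le_of_pow_four_eq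
    (h : ∀ x : K, x ≠ 0 → 1 + x ^ 2 ≠ 0 → (1 + x ^ 2) ^ 4 = (x ^ 2) ^ 2) : Nat.card K ≤ 11 := by
  classical
  have := Fintype.ofFinite K
  -- The first two factors absorb the excluded values of `x`; the degree is `1 + 2 + 8 = 11`.
  set P : K[X] := X * (1 + X ^ 2) * ((1 + X ^ 2) ^ 4 - (X ^ 2) ^ 2) with hP
  have hdeg : P.natDegree = 11 := by
    rw [hP]; compute_degree!
  have hP0 : P ≠ 0 := by
    intro h0; rw [h0] at hdeg; simp at hdeg
  have := card_le_degree_of_subset_roots (p := P) (Z := Finset.univ) fun x _ => by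
    rw [mem_roots hP0, IsRoot, hP]
    simp only [eval_mul, eval_X, eval_add, eval_one, eval_pow, eval_sub]
    by_cases h0 : x = 0
    · simp [h0]
    by_cases h1 : 1 + x ^ 2 = 0
    · simp [h1]
    rw [h x h0 h1, sub_self, mul_zero]
  rwa [hdeg, Finset.card_univ, ← Nat.card_eq_fintype_card] at this

omit [Finite K] in
theorem RingEquiv.eq_one_of_fix_generator {t : Kˣ} (ht : ∀ x, x ∈ Subgroup.zpowers t)
    {σ : K ≃+* K} (h : σ t = t) : σ = 1 := by
  ext x
  by_cases hx : x = 0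
  · simp [hx]
  obtain ⟨n, hn⟩ := ht (Units.mk0 x hx)
  have hn : (t : K) ^ n = x := by simpa using congrArg Units.val hn
  rw [← hn, map_zpow₀, h, RingAut.one_apply]

/-- In a finite field of odd order more than `11` in which `-1` is a square, there is an element
`a`, fixed by no nontrivial automorphism, such that `a` and `1 - a` are squares. -/
theorem exists_generating_square_pair (h2 : (2 : K) ≠ 0) (hm1 : IsSquare (-1 : K))
    (hcard : 11 < Nat.card K) :
    ∃ a : K, IsSquare a ∧ IsSquare (1 - a) ∧ ∀ σ : K ≃+* K, σ a = a → σ = 1 := by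
  obtain ⟨t, ht⟩ := IsCyclic.exists_generator (α := Kˣ)
  have ht0 : (t : K) ≠ 0 := t.ne_zero
  obtain ⟨i, hi⟩ := hm1
  -- For this `a`, `1 - a = -((t - t⁻¹) / 2) ^ 2` is a square because `-1 = i * i`. If `σ` fixes
  -- `a`, then `σ (t ^ 2)` is `t ^ 2` or its inverse.
  refine ⟨(((t : K) + (t : K)⁻¹) / 2) ^ 2, IsSquare.sq _,
    ⟨i * (((t : K) - (t : K)⁻¹) / 2), ?_⟩, fun σ hσ => ?_⟩
  · field_simp
    linear_combination ((t : K) ^ 2 - 1) ^ 2 * hi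
  · have hu0 : σ t ≠ 0 := by simp
    have e : (σ t + (σ t)⁻¹) ^ 2 = ((t : K) + (t : K)⁻¹) ^ 2 := by
      rw [map_pow, map_div₀, map_add, map_inv₀, map_ofNat, div_pow, div_pow] at hσ
      exact (div_left_inj' (pow_ne_zero 2 h2)).1 hσ
    have e' : (σ t ^ 2 - (t : K) ^ 2) * (σ t ^ 2 * (t : K) ^ 2 - 1) = 0 := by
      field_simp at e
      linear_combination e
    have hpow : ∀ x : K, x ≠ 0 → ∃ n : ℤ, x ^ 2 = ((t : K) ^ 2) ^ n := by
      intro x hx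
      obtain ⟨n, hn⟩ := ht (Units.mk0 x hx)
      have hn : (t : K) ^ n = x := by simpa using congrArg Units.val hn
      exact ⟨n, by rw [← hn, ← zpow_natCast, ← zpow_natCast, ← zpow_mul, ← zpow_mul, mul_comm]⟩
    rcases mul_eq_zero.1 e' with h | h
    · have hsq : ∀ x : K, σ (x ^ 2) = x ^ 2 := by
        intro x
        by_cases hx : x = 0
        · simp [hx]
        obtain ⟨n, hn⟩ := hpow x hx
        rw [hn, map_zpow₀, map_pow, sub_eq_zero.1 h]
      ext x
      have h1 := hsq (x + 1)
      have h3 := hsq (x - 1)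
      simp only [map_pow, map_add, map_sub, map_one] at h1 h3
      apply mul_left_cancel₀ (mul_ne_zero h2 h2)
      rw [RingAut.one_apply]
      linear_combination h1 - h3
    · exfalso
      -- If `σ` inverts all nonzero squares, comparing its values at `x ^ 2` and `(1 + x ^ 2) ^ 2`
      -- gives a polynomial identity too strong for a field of more than `11` elements.
      have hsq : ∀ x : K, x ≠ 0 → σ (x ^ 2) = (x ^ 2)⁻¹ := by
        intro x hx
        obtain ⟨n, hn⟩ := hpow x hx
        rw [hn, map_zpow₀, map_pow, ← inv_zpow]
        congr 1
        exact eq_inv_of_mul_eq_one_left (sub_eq_zero.1 h)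
      have := card_le_of_pow_four_eq (K := K) fun x hx hx1 => by
        have e1 := hsq x hx
        have e2 := hsq _ hx1
        rw [map_pow, map_add, map_one, e1] at e2
        field_simp at e2
        linear_combination e2
      omega

theorem Subfield.exists_generating_square_pair (F : Subfield K)
    (hK : Nat.card K = Nat.card F ^ 2) (hF : 4 ≤ Nat.card F) :
    ∃ a : K, a ∉ F ∧ IsSquare a ∧ IsSquare (1 - a) ∧ ∀ σ : K ≃+* K, σ a = a → σ = 1 := by
  obtain ⟨τ, -, hfix, -, x, hx⟩ := F.exists_involution hK
  have hnot : ∀ a : K, (∀ σ : K ≃+* K, σ a = a → σ = 1) → a ∉ F := fun a ha haF =>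
    hx (by rw [ha τ ((hfix a).2 haF)]; rfl)
  suffices h : ∃ a : K, IsSquare a ∧ IsSquare (1 - a) ∧ ∀ σ : K ≃+* K, σ a = a → σ = 1 by
    obtain ⟨a, h1, h2, h3⟩ := h
    exact ⟨a, hnot a h3, h1, h2, h3⟩
  by_cases h2 : ringChar K = 2
  · obtain ⟨t, ht⟩ := IsCyclic.exists_generator (α := Kˣ)
    exact ⟨t, FiniteField.isSquare_of_char_two h2 _, FiniteField.isSquare_of_char_two h2 _,
      fun σ hσ => RingEquiv.eq_one_of_fix_generator ht hσ⟩
  · exact _root_.exists_generating_square_pair (Ring.two_ne_zero h2)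
      (F.isSquare_of_mem hK (F.neg_mem F.one_mem)) (by rw [hK]; nlinarith)

/-- If all squares lay in `F`, then so would `2 * x = (1 + x) ^ 2 - x ^ 2 - 1`, and with `x ^ 2`
also `x`. -/
theorem Subfield.exists_isSquare_notMem (F : Subfield K)
    (hK : Nat.card K = Nat.card F ^ 2) : ∃ a : K, a ∉ F ∧ IsSquare a := by
  obtain ⟨τ, -, hfix, -, x, hx⟩ := F.exists_involution hK
  have hxF : x ∉ F := fun h => hx ((hfix x).2 h)
  by_contra! h
  have hsq : ∀ y : K, y ^ 2 ∈ F := fun y => by_contra fun hy => h _ hy (IsSquare.sq y)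
  apply hxF
  apply F.mem_of_two_mul_mem_of_sq_mem _ (hsq x)
  convert F.sub_mem (F.sub_mem (hsq (1 + x)) (hsq x)) F.one_mem using 1
  ring

end FieldElements

/-! ### Two sublines always have a common stabilising element -/

section PairStabilisers

variable {K : Type*} [Field K] [Finite K]

/-- For any invertible `X` with `X * τ X = 1`, where `τ` is the involution with fixed field `F`,
some nonscalar invertible matrix over `F` commutes with `X`. -/
theorem exists_nonscalar_commute (F : Subfield K) (hF : 3 ≤ Nat.card F) (τ : K ≃+* K)
    (hfix : ∀ x, τ x = x ↔ x ∈ F) (hinv : ∀ x, τ (τ x) = x) (hne : ∃ x, τ x ≠ x)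
    (X : GL (Fin 2) K) (hX : glMap τ X = X⁻¹) :
    ∃ B : Matrix (Fin 2) (Fin 2) K, (∀ i j, B i j ∈ F) ∧ B * X.1 = X.1 * B ∧ B.det ≠ 0 ∧
      ¬(B 0 1 = 0 ∧ B 1 0 = 0 ∧ B 0 0 = B 1 1) := by
  suffices h : ∃ B : Matrix (Fin 2) (Fin 2) K, (∀ i j, B i j ∈ F) ∧ B * X.1 = X.1 * B ∧
      ¬(B 0 1 = 0 ∧ B 1 0 = 0 ∧ B 0 0 = B 1 1) by
    obtain ⟨B, hBF, hBX, hB⟩ := h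
    -- The determinant is a monic quadratic in `c`, so it cannot vanish at three elements `0`, `1`,
    -- `u` of `F`.
    have hc : ∃ c ∈ F, (B + Matrix.scalar (Fin 2) c).det ≠ 0 := by
      obtain ⟨u, hu0, hu1⟩ : ∃ u : F, u ≠ 0 ∧ u ≠ 1 := by
        classical
        have := Fintype.ofFinite F
        rw [Nat.card_eq_fintype_card] at hF
        by_contra! h
        have hsub : (Finset.univ : Finset F) ⊆ {0, 1} := fun u _ => by
          by_cases hu : u = 0
          · simp [hu]
          · simp [h u hu]
        have := (Finset.card_le_card hsub).trans Finset.card_le_two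
        rw [Finset.card_univ] at this
        omega
      by_contra! h
      have d : ∀ c, (B + Matrix.scalar (Fin 2) c).det =
          (B 0 0 + c) * (B 1 1 + c) - B 0 1 * B 1 0 := fun c => by
        rw [Matrix.det_fin_two]; simp
      have e0 := h 0 F.zero_mem
      have e1 := h 1 F.one_mem
      have eu := h u u.2
      rw [d] at e0 e1 eu
      have : (u : K) * (u - 1) = 0 := by linear_combination eu - u * e1 + (u - 1) * e0
      rcases mul_eq_zero.1 this with h | h
      · exact hu0 (Subtype.ext h)
      · exact hu1 (Subtype.ext (sub_eq_zero.1 h))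
    obtain ⟨c, hcF, hc⟩ := hc
    refine ⟨B + Matrix.scalar (Fin 2) c, fun i j => ?_, ?_, hc, ?_⟩
    · rw [Matrix.add_apply]
      refine F.add_mem (hBF i j) ?_
      fin_cases i <;> fin_cases j <;> simp [hcF]
    · rw [add_mul, mul_add, hBX, Matrix.scalar_commute c (fun r => mul_comm c r) X.1]
    · simpa using hB
  have hτ : ∀ i j, τ (X.1 i j) = (X⁻¹).1 i j := fun i j => by rw [← hX]; rfl
  have hinvX : (X⁻¹).1 = (X.1.det)⁻¹ • X.1.adjugate := by
    rw [Matrix.GeneralLinearGroup.coe_inv, Matrix.inv_def, Ring.inverse_eq_inv']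
  by_cases hs : X.1 0 1 = 0 ∧ X.1 1 0 = 0 ∧ X.1 0 0 = X.1 1 1
  · refine ⟨!![1, 1; 0, 1], fun i j => ?_, ?_, by simp⟩
    · fin_cases i <;> fin_cases j <;> simp
    · rw [Matrix.eta_fin_two X.1]
      simp [hs]
  -- Since `X⁻¹` is the adjugate over `det X`, this factor multiplies the off-diagonal entries and
  -- the diagonal difference of `X` in `α X + τ(α) X⁻¹`. Its vanishing for all `α` would give `τ =
  -- 1`.
  · obtain ⟨α, hα⟩ : ∃ α : K, α - τ α * (X.1.det)⁻¹ ≠ 0 := by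
      by_contra! h
      obtain ⟨x, hx⟩ := hne
      have h1 := h 1
      have h2 := h x
      rw [map_one, one_mul, sub_eq_zero] at h1
      rw [← h1, mul_one, sub_eq_zero] at h2
      exact hx h2.symm
    refine ⟨α • X.1 + τ α • (X⁻¹).1, fun i j => ?_, ?_, ?_⟩
    · rw [← hfix, Matrix.add_apply, Matrix.smul_apply, Matrix.smul_apply, smul_eq_mul,
        smul_eq_mul, map_add, map_mul, map_mul, hinv, hτ, ← hτ, hinv, add_comm]
    · simp only [add_mul, mul_add, Matrix.smul_mul, Matrix.mul_smul, Units.inv_mul, Units.mul_inv]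
    · rintro ⟨h01, h10, h00⟩
      apply hs
      rw [hinvX, Matrix.adjugate_fin_two] at h01 h10 h00
      simp at h01 h10 h00
      refine ⟨mul_left_cancel₀ hα ?_, mul_left_cancel₀ hα ?_, mul_left_cancel₀ hα ?_⟩
      · linear_combination h01
      · linear_combination h10
      · linear_combination h00

omit [Finite K] in
theorem pslMk_ne_one {A : SL(2, K)} (h : ¬(A.1 0 1 = 0 ∧ A.1 1 0 = 0 ∧ A.1 0 0 = A.1 1 1)) :
    pslMk A ≠ 1 := by
  intro h1
  rw [← map_one pslMk, eq_comm, pslMk_eq_iff] at h1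
  obtain ⟨e, -, he⟩ := h1
  apply h
  rw [he]
  simp

-- Division by a square root of the determinant. This is the source of the square conditions: a form
-- with a matrix of square determinant lies in the `L₂(K)`-orbit of the standard form.
omit [Finite K] in
theorem exists_sl_of_isSquare_det {B : Matrix (Fin 2) (Fin 2) K} (h0 : B.det ≠ 0)
    (h : IsSquare B.det) : ∃ (A : SL(2, K)) (c : K), c ≠ 0 ∧ A.1 = c • B := by
  obtain ⟨s, hs⟩ := h
  have hs0 : s ≠ 0 := by rintro rfl; simp at hs; exact h0 hs
  refine ⟨⟨s⁻¹ • B, ?_⟩, s⁻¹, inv_ne_zero hs0, rfl⟩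
  rw [Matrix.det_smul, hs, Fintype.card_fin]
  field_simp

/-- Two subfield subgroups are normalised by a common nontrivial element of `L₂(K)`. -/
theorem exists_ne_one_normalising_pair (F : Subfield K) (hK : Nat.card K = Nat.card F ^ 2)
    (hF : 3 ≤ Nat.card F) (A₁ A₂ : SL(2, K)) :
    ∃ M : SL(2, K), pslMk M ≠ 1 ∧ HasEntriesUpToScalar F (A₁⁻¹ * M * A₁).1 ∧
      HasEntriesUpToScalar F (A₂⁻¹ * M * A₂).1 := by
  obtain ⟨τ, -, hfix, hinv, hne⟩ := F.exists_involution hK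
  set C := A₁⁻¹ * A₂ with hC
  set X := C * (slFieldAut τ C)⁻¹ with hX
  have hττ : ∀ A : SL(2, K), slFieldAut τ (slFieldAut τ A) = A := fun A => by
    apply Subtype.ext
    ext i j
    rw [slFieldAut_apply, slFieldAut_apply, hinv]
  have hXτ : slFieldAut τ X = X⁻¹ := by
    rw [hX, map_mul, map_inv, hττ]; group
  obtain ⟨B, hBF, hBX, hB0, hBns⟩ := exists_nonscalar_commute F hF τ hfix hinv hne
    (Matrix.SpecialLinearGroup.toGL X) (by
      rw [← map_inv, ← hXτ]; exact Units.ext rfl)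
  have hdetF : B.det ∈ F := by
    rw [Matrix.det_fin_two]
    exact F.sub_mem (F.mul_mem (hBF _ _) (hBF _ _)) (F.mul_mem (hBF _ _) (hBF _ _))
  obtain ⟨M, c, hc, hM⟩ := exists_sl_of_isSquare_det hB0 (F.isSquare_of_mem hK hdetF)
  have hMX : Commute M X := by
    apply Subtype.ext
    change M.1 * X.1 = X.1 * M.1
    rw [hM, Matrix.smul_mul, Matrix.mul_smul]
    exact congrArg (c • ·) hBX
  have hMns : ¬(M.1 0 1 = 0 ∧ M.1 1 0 = 0 ∧ M.1 0 0 = M.1 1 1) := by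
    simpa [hM, hc] using hBns
  have hMF : ∀ i j, c⁻¹ * M.1 i j ∈ F := fun i j => by
    rw [hM]; simpa [hc] using hBF i j
  refine ⟨A₁ * M * A₁⁻¹, fun h => pslMk_ne_one hMns ?_, ?_, ?_⟩
  · rw [map_mul, map_mul, map_inv, mul_inv_eq_one, mul_eq_left] at h
    exact h
  · have : A₁⁻¹ * (A₁ * M * A₁⁻¹) * A₁ = M := by group
    rw [this]
    exact ⟨c⁻¹, inv_ne_zero hc, hMF⟩
  · have : A₂⁻¹ * (A₁ * M * A₁⁻¹) * A₂ = C⁻¹ * M * C := by rw [hC]; group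
    rw [this]
    refine ⟨c⁻¹, inv_ne_zero hc, fun i j => ?_⟩
    have hMτ : (slFieldAut τ M).1 = (τ c / c) • M.1 := by
      ext i j
      rw [slFieldAut_apply, Matrix.smul_apply, smul_eq_mul]
      have := (hfix _).2 (hMF i j)
      rw [map_mul, map_inv₀] at this
      have hc' : τ c ≠ 0 := by simpa
      field_simp at this ⊢
      linear_combination this
    have hCτ : slFieldAut τ C = X⁻¹ * C := by rw [hX]; group
    -- Because `M` commutes with `X = C τ(C)⁻¹`, its conjugate by `C` is multiplied by the same
    -- factor under `τ` as `M` itself, so the scalar `c⁻¹` also brings the conjugate into `F`.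
    have key : (slFieldAut τ (C⁻¹ * M * C)).1 = (τ c / c) • (C⁻¹ * M * C).1 := by
      have e1 : slFieldAut τ (C⁻¹ * M * C) = C⁻¹ * (X * slFieldAut τ M * X⁻¹) * C := by
        rw [map_mul, map_mul, map_inv, hCτ]; group
      have e2 : C⁻¹ * M * C = C⁻¹ * (X * M * X⁻¹) * C := by
        rw [← hMX.eq]; group
      rw [e1, e2]
      simp only [Matrix.SpecialLinearGroup.coe_mul, hMτ, Matrix.smul_mul, Matrix.mul_smul]
    have := congrFun (congrFun key i) j
    rw [slFieldAut_apply, Matrix.smul_apply, smul_eq_mul] at this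
    rw [← hfix, map_mul, this, map_inv₀]
    have hc' : τ c ≠ 0 := by simpa
    field_simp

end PairStabilisers

/-! ### Three sublines over the field of nine elements -/

section OrderNine

/-- Coordinates for the four-dimensional quadratic space over the field of three elements
attached to Baer sublines of the projective line over the field of nine elements. -/
abbrev SublineVec := ZMod 3 × ZMod 3 × ZMod 3 × ZMod 3

/-- The polar form on the space of subline vectors. -/
def sublinePolar (x y : SublineVec) : ZMod 3 :=
  2 * (x.1 * y.1 + x.2.1 * y.2.1) + (x.2.2.1 * y.2.2.2 + x.2.2.2 * y.2.2.1)

/-- The quadratic form on the space of subline vectors. -/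
def sublineNorm (x : SublineVec) : ZMod 3 :=
  x.1 * x.1 + x.2.1 * x.2.1 + x.2.2.1 * x.2.2.2

/-- Equality up to sign or orthogonality of subline vectors. -/
def SublineCommute (z x : SublineVec) : Prop := z = x ∨ z = -x ∨ sublinePolar z x = 0

instance (z x : SublineVec) : Decidable (SublineCommute z x) := by
  unfold SublineCommute; infer_instance

-- The list consists, up to sign, of `(1, 0, 0, 0)` and all norm-one vectors orthogonal to it; the
-- first of the three sublines is normalised to that vector.
set_option synthInstance.maxHeartbeats 400000 in
set_option synthInstance.maxSize 1000 in
theorem exists_sublineCommute_aux : ∀ x : SublineVec, sublineNorm x = 1 →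
    ∀ y : SublineVec, sublineNorm y = 1 →
    ∃ z ∈ ([(1, 0, 0, 0), (0, 1, 0, 0), (0, 1, 0, 1), (0, 1, 0, -1), (0, 1, 1, 0), (0, 1, -1, 0),
      (0, 0, 1, 1)] : List SublineVec),
      (sublineNorm z = 1 ∧ SublineCommute z (1, 0, 0, 0)) ∧
        SublineCommute z x ∧ SublineCommute z y := by
  decide +kernel

variable {K : Type*} [Field K]

/-- The matrix of determinant one attached to a subline vector. -/
def sublineMatrix (f : ZMod 3 →+* K) (i : K) (x : SublineVec) : Matrix (Fin 2) (Fin 2) K :=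
  !![f x.1 + i * f x.2.1, i * f x.2.2.1; i * f x.2.2.2, f x.1 - i * f x.2.1]

theorem det_sublineMatrix (f : ZMod 3 →+* K) {i : K} (hi : i * i = -1) (x : SublineVec) :
    (sublineMatrix f i x).det = f (sublineNorm x) := by
  rw [sublineMatrix, Matrix.det_fin_two_of, sublineNorm]
  simp only [map_add, map_mul]
  linear_combination (-(f x.2.1) ^ 2 - f x.2.2.1 * f x.2.2.2) * hi

/-- Since `X⁻¹` is the adjugate, `τ` swaps the diagonal entries and negates the others. Half the
trace, and half the diagonal difference and the off-diagonal entries divided by `i`, are thus fixed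
by `τ` and lie in the prime field. -/
theorem exists_eq_sublineMatrix [Finite K] {F : Subfield K} (hF : Nat.card F = 3)
    (h2 : (2 : K) ≠ 0) (f : ZMod 3 →+* K) {i : K} (hi : i * i = -1) {τ : K ≃+* K}
    (hfix : ∀ x, τ x = x ↔ x ∈ F) (hinv : ∀ x, τ (τ x) = x) (hτi : τ i = -i) (X : SL(2, K))
    (hX : slFieldAut τ X = X⁻¹) : ∃ x, sublineNorm x = 1 ∧ X.1 = sublineMatrix f i x := by
  have hsurj : ∀ y : K, τ y = y → ∃ n, f n = y := by
    intro y hy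
    have := (F.mem_iff_pow_card_eq y).1 ((hfix y).1 hy)
    rw [hF] at this
    have : y * ((y - 1) * (y + 1)) = 0 := by linear_combination this
    rcases mul_eq_zero.1 this with h | h
    · exact ⟨0, by simp [h]⟩
    rcases mul_eq_zero.1 h with h | h
    · exact ⟨1, by simp [sub_eq_zero.1 h]⟩
    · exact ⟨-1, by simp [eq_neg_of_add_eq_zero_left h]⟩
  have hi0 : i ≠ 0 := by rintro rfl; simp at hi
  have hτ : ∀ j k, τ (X.1 j k) = (X⁻¹).1 j k := fun j k => by rw [← hX]; rfl
  rw [Matrix.SpecialLinearGroup.coe_inv, Matrix.adjugate_fin_two] at hτ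
  have h00 := hτ 0 0
  have h01 := hτ 0 1
  have h10 := hτ 1 0
  simp at h00 h01 h10
  have h11 : τ (X.1 1 1) = X.1 0 0 := by rw [← h00, hinv]
  have hτ2 : τ 2 = 2 := map_ofNat τ 2
  obtain ⟨a, ha⟩ := hsurj ((X.1 0 0 + X.1 1 1) / 2) (by
    rw [map_div₀, map_add, h00, h11, hτ2, add_comm])
  obtain ⟨b, hb⟩ := hsurj ((X.1 0 0 - X.1 1 1) / (2 * i)) (by
    rw [map_div₀, map_sub, h00, h11, map_mul, hτ2, hτi]; field_simp; ring)
  obtain ⟨c, hc⟩ := hsurj (X.1 0 1 / i) (by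
    rw [map_div₀, h01, hτi]; field_simp)
  obtain ⟨d, hd⟩ := hsurj (X.1 1 0 / i) (by
    rw [map_div₀, h10, hτi]; field_simp)
  have hXm : X.1 = sublineMatrix f i (a, b, c, d) := by
    rw [Matrix.eta_fin_two X.1, sublineMatrix]
    simp only [ha, hb, hc, hd]
    congr 1
    ext j k
    fin_cases j <;> fin_cases k <;> simp <;> field_simp <;> ring
  refine ⟨(a, b, c, d), f.injective ?_, hXm⟩
  rw [← det_sublineMatrix f hi, ← hXm, X.2, map_one]

/-- The polar form is the trace of `Z * X⁻¹`, and a determinant-one matrix of trace zero squares to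
`-1`. -/
theorem sq_eq_of_sublineCommute (f : ZMod 3 →+* K) {i : K} (hi : i * i = -1) {x z : SublineVec}
    (h : SublineCommute z x) {X Z : SL(2, K)} (hX : X.1 = sublineMatrix f i x)
    (hZ : Z.1 = sublineMatrix f i z) :
    (Z * X⁻¹).1 * (Z * X⁻¹).1 = 1 ∨ (Z * X⁻¹).1 * (Z * X⁻¹).1 = -1 := by
  rcases h with rfl | rfl | h
  · left
    have : Z = X := Subtype.ext (by rw [hX, hZ])
    rw [this, mul_inv_cancel, Matrix.SpecialLinearGroup.coe_one, mul_one]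
  · left
    have : Z.1 = -X.1 := by
      rw [hX, hZ]
      ext j k
      fin_cases j <;> fin_cases k <;> simp [sublineMatrix] <;> ring
    rw [Matrix.SpecialLinearGroup.coe_mul, this, neg_mul, neg_mul_neg,
      ← Matrix.SpecialLinearGroup.coe_mul, mul_inv_cancel, Matrix.SpecialLinearGroup.coe_one,
      mul_one]
  · right
    have htr : (Z * X⁻¹).1 0 0 + (Z * X⁻¹).1 1 1 = 0 := by
      have := congrArg f h
      rw [sublinePolar] at this
      simp only [map_add, map_mul, map_zero, map_ofNat] at this
      rw [Matrix.SpecialLinearGroup.coe_mul, Matrix.SpecialLinearGroup.coe_inv, hX, hZ,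
        sublineMatrix, sublineMatrix, Matrix.adjugate_fin_two_of]
      simp
      linear_combination this - (2 * f z.2.1 * f x.2.1 + f z.2.2.1 * f x.2.2.2 +
        f z.2.2.2 * f x.2.2.1) * hi
    have hdet := (Z * X⁻¹).2
    generalize (Z * X⁻¹).1 = W at *
    rw [Matrix.det_fin_two] at hdet
    have h11 : W 1 1 = -W 0 0 := by linear_combination htr
    rw [Matrix.eta_fin_two W]
    rw [h11] at hdet ⊢
    ext j k
    fin_cases j <;> fin_cases k <;> simp <;>
      first | ring1 | linear_combination -hdet

/-- The matrix `M = C⁻¹ Z τ(C)` is conjugate to `W = Z X⁻¹` and satisfies `τ(M) = M⁻¹`. If `M² = 1`,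
it is fixed by `τ`; if `M² = -1`, then `i M` is. -/
theorem hasEntriesUpToScalar_of_sq {F : Subfield K} {i : K} (hi : i * i = -1) {τ : K ≃+* K}
    (hfix : ∀ x, τ x = x ↔ x ∈ F) (hτi : τ i = -i) (C Z : SL(2, K))
    (hinv : ∀ x, τ (τ x) = x) (hZ : slFieldAut τ Z = Z⁻¹)
    (h : (Z * (C * (slFieldAut τ C)⁻¹)⁻¹).1 * (Z * (C * (slFieldAut τ C)⁻¹)⁻¹).1 = 1 ∨
      (Z * (C * (slFieldAut τ C)⁻¹)⁻¹).1 * (Z * (C * (slFieldAut τ C)⁻¹)⁻¹).1 = -1) :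
    HasEntriesUpToScalar F (C⁻¹ * Z * slFieldAut τ C).1 := by
  have hi0 : i ≠ 0 := by rintro rfl; simp at hi
  have hττ : ∀ A : SL(2, K), slFieldAut τ (slFieldAut τ A) = A := fun A => by
    apply Subtype.ext
    ext i j
    rw [slFieldAut_apply, slFieldAut_apply, hinv]
  set W := Z * (C * (slFieldAut τ C)⁻¹)⁻¹ with hW
  set M := C⁻¹ * Z * slFieldAut τ C with hM
  have hMW : M = C⁻¹ * W * C := by rw [hM, hW]; group
  have hτM : slFieldAut τ M = M⁻¹ := by
    rw [hM, map_mul, map_mul, hττ, map_inv, hZ]; group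
  have hτ : ∀ j k, τ (M.1 j k) = (M⁻¹).1 j k := fun j k => by rw [← hτM]; rfl
  have hMM : (M.1 * M.1) = (C⁻¹).1 * (W.1 * W.1) * C.1 := by
    have : M * M = C⁻¹ * (W * W) * C := by rw [hMW]; group
    exact congrArg Subtype.val this
  have hCC : (C⁻¹).1 * C.1 = 1 := by
    rw [← Matrix.SpecialLinearGroup.coe_mul, inv_mul_cancel, Matrix.SpecialLinearGroup.coe_one]
  have hMinv : (M⁻¹).1 * M.1 = 1 := by
    rw [← Matrix.SpecialLinearGroup.coe_mul, inv_mul_cancel, Matrix.SpecialLinearGroup.coe_one]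
  rcases h with h | h
  · rw [h, mul_one, hCC] at hMM
    have : (M⁻¹).1 = M.1 := by
      calc (M⁻¹).1 = (M⁻¹).1 * (M.1 * M.1) := by rw [hMM, mul_one]
        _ = M.1 := by rw [← mul_assoc, hMinv, one_mul]
    exact HasEntriesUpToScalar.of_mem fun j k => by rw [← hfix, hτ, this]
  · rw [h, mul_neg, mul_one, neg_mul, hCC] at hMM
    have : (M⁻¹).1 = -M.1 := by
      calc (M⁻¹).1 = -((M⁻¹).1 * (M.1 * M.1)) := by rw [hMM, mul_neg, mul_one, neg_neg]
        _ = -M.1 := by rw [← mul_assoc, hMinv, one_mul]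
    exact ⟨i, hi0, fun j k => by
      rw [← hfix, map_mul, hτi, hτ, this, Matrix.neg_apply, neg_mul_neg]⟩

/-- Over the field of nine elements, any three subfield subgroups in an `L₂`-orbit are normalised
by a common involutory semilinear automorphism. -/
theorem exists_normalising_triple [Finite K] {F : Subfield K} (hF : Nat.card F = 3)
    (hK : Nat.card K = Nat.card F ^ 2) {τ : K ≃+* K}
    (hpow : ∀ x, τ x = x ^ Nat.card F) (hfix : ∀ x, τ x = x ↔ x ∈ F)
    (hinv : ∀ x, τ (τ x) = x) (A₁ A₂ A₃ : SL(2, K)) :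
    ∃ Z : SL(2, K), HasEntriesUpToScalar F (A₁⁻¹ * Z * slFieldAut τ A₁).1 ∧
      HasEntriesUpToScalar F (A₂⁻¹ * Z * slFieldAut τ A₂).1 ∧
      HasEntriesUpToScalar F (A₃⁻¹ * Z * slFieldAut τ A₃).1 := by
  have : Fact (Nat.Prime 3) := ⟨Nat.prime_three⟩
  have : Fintype F := Fintype.ofFinite F
  have : CharP F 3 := charP_of_card_eq_prime (by rw [← hF, Nat.card_eq_fintype_card])
  have : CharP K 3 := charP_of_injective_ringHom F.subtype.injective 3
  have h3 : (3 : K) = 0 := by exact_mod_cast CharP.cast_eq_zero K 3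
  have h2 : (2 : K) ≠ 0 := fun h2 => one_ne_zero (α := K) (by linear_combination h3 - h2)
  let f : ZMod 3 →+* K := ZMod.castHom (dvd_refl 3) K
  obtain ⟨i, hi⟩ := F.isSquare_of_mem hK (F.neg_mem F.one_mem)
  have hi : i * i = -1 := hi.symm
  have hτi : τ i = -i := by
    rw [hpow, hF]; linear_combination i * hi
  have hττ : ∀ A : SL(2, K), slFieldAut τ (slFieldAut τ A) = A := fun A => by
    apply Subtype.ext
    ext i j
    rw [slFieldAut_apply, slFieldAut_apply, hinv]
  have hvec : ∀ C : SL(2, K), ∃ x, sublineNorm x = 1 ∧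
      (C * (slFieldAut τ C)⁻¹).1 = sublineMatrix f i x := fun C =>
    exists_eq_sublineMatrix hF h2 f hi hfix hinv hτi _ (by
      rw [map_mul, map_inv, hττ]; group)
  obtain ⟨x, hx, hxm⟩ := hvec (A₁⁻¹ * A₂)
  obtain ⟨y, hy, hym⟩ := hvec (A₁⁻¹ * A₃)
  obtain ⟨z, -, ⟨hz, hze⟩, hzx, hzy⟩ := exists_sublineCommute_aux x hx y hy
  have hem : ((1 : SL(2, K)) * (slFieldAut τ 1)⁻¹).1 = sublineMatrix f i (1, 0, 0, 0) := by
    rw [map_one, inv_one, mul_one, Matrix.SpecialLinearGroup.coe_one, sublineMatrix]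
    simp [Matrix.one_fin_two]
  let Z : SL(2, K) := ⟨sublineMatrix f i z, by rw [det_sublineMatrix f hi, hz, map_one]⟩
  have hτf : ∀ n, τ (f n) = f n := fun n => by
    have : (τ : K →+* K).comp f = f := Subsingleton.elim _ _
    exact congrArg (fun g : ZMod 3 →+* K => g n) this
  have hZ : slFieldAut τ Z = Z⁻¹ := by
    apply Subtype.ext
    rw [Matrix.SpecialLinearGroup.coe_inv]
    change _ = (sublineMatrix f i z).adjugate
    ext j k
    rw [slFieldAut_apply]
    change τ (sublineMatrix f i z j k) = _
    rw [sublineMatrix, Matrix.adjugate_fin_two_of]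
    fin_cases j <;> fin_cases k <;> simp [hτf, hτi] <;> ring
  have key : ∀ (C : SL(2, K)) x, SublineCommute z x →
      (C * (slFieldAut τ C)⁻¹).1 = sublineMatrix f i x →
      HasEntriesUpToScalar F (C⁻¹ * Z * slFieldAut τ C).1 := fun C x hzx hC =>
    hasEntriesUpToScalar_of_sq hi hfix hτi C Z hinv hZ
      (sq_eq_of_sublineCommute f hi hzx hC rfl)
  refine ⟨A₁ * Z * (slFieldAut τ A₁)⁻¹, ?_, ?_, ?_⟩
  · have := key 1 _ hze hem
    convert this using 2
    simp only [map_one]; group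
  · convert key _ _ hzx hxm using 2
    simp only [map_mul, map_inv]; group
  · convert key _ _ hzy hym using 2
    simp only [map_mul, map_inv]; group

end OrderNine

/-! ### Almost simple groups act faithfully on their socle -/

section AlmostSimple

variable {G : Type*} [Group G]

instance socle_normal : (socle G).Normal :=
  Subgroup.sSup_normal _ fun N hN =>
    (show Minimal (fun M : Subgroup G => M.Normal ∧ M ≠ ⊥) N from hN).prop.1

theorem center_eq_bot_of_simple {S : Type*} [Group S] [IsSimpleGroup S]
    (h : ∃ x y : S, x * y ≠ y * x) : Subgroup.center S = ⊥ := by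
  rcases (inferInstance : (Subgroup.center S).Normal).eq_bot_or_eq_top with hb | ht
  · exact hb
  · obtain ⟨x, y, hxy⟩ := h
    exact absurd (Subgroup.mem_center_iff.1 (ht ▸ Subgroup.mem_top y : y ∈ Subgroup.center S) x) hxy

/-- In a finite almost simple group, the centraliser of the socle is trivial. -/
theorem IsAlmostSimple.centralizer_socle [Finite G] (hG : IsAlmostSimple G) :
    Subgroup.centralizer (socle G : Set G) = ⊥ := by
  by_contra hne
  have hnormal : (Subgroup.centralizer (socle G : Set G)).Normal := inferInstance
  -- A minimal normal subgroup inside the centraliser also lies in the socle, hence in the trivial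
  -- centre of the socle.
  obtain ⟨N, hN, hmin⟩ := exists_minimal_le_of_wellFoundedLT
    (fun M : Subgroup G => M.Normal ∧ M ≠ ⊥) _ ⟨hnormal, hne⟩
  have hNS : N ≤ socle G := le_sSup hmin
  have := hG.1
  have hc := center_eq_bot_of_simple hG.2
  apply hmin.prop.2
  rw [Subgroup.eq_bot_iff_forall]
  intro x hx
  have : (⟨x, hNS hx⟩ : socle G) ∈ Subgroup.center (socle G) :=
    Subgroup.mem_center_iff.2 fun y => Subtype.ext (Subgroup.mem_centralizer_iff.1 (hN hx) y y.2)
  rw [hc, Subgroup.mem_bot] at this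
  exact congrArg Subtype.val this

theorem IsAlmostSimple.conjNormal_injective [Finite G] (hG : IsAlmostSimple G) :
    Function.Injective (MulAut.conjNormal : G →* MulAut (socle G)) := by
  rw [injective_iff_map_eq_one]
  intro k hk
  have : k ∈ Subgroup.centralizer (socle G : Set G) := by
    rw [Subgroup.mem_centralizer_iff]
    intro y hy
    have h1 := congrArg (fun α : MulAut (socle G) => ((α ⟨y, hy⟩ : socle G) : G)) hk
    simp only [MulAut.conjNormal_apply, MulAut.one_apply] at h1
    exact (mul_inv_eq_iff_eq_mul.1 h1).symm
  rwa [hG.centralizer_socle, Subgroup.mem_bot] at this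

end AlmostSimple

/-! ### Translation of the primitive action into an action on sublines -/

/-- A transitive action of a group `G` between `L₂(K)` and its automorphism group, whose point
stabiliser is the normaliser of the standard subfield subgroup over `F`. -/
structure SublineAction {K : Type*} [Field K] (F : Subfield K) (G Ω : Type*) [Group G]
    [MulAction G Ω] where
  /-- The action on `L₂(K)`. -/
  toAut : G →* MulAut PSL(2, K)
  /-- The inclusion of `L₂(K)`. -/
  ofPSL : PSL(2, K) →* G
  /-- The base point. -/
  base : Ω
  toAut_injective : Function.Injective toAut
  ofPSL_injective : Function.Injective ofPSL
  toAut_ofPSL : ∀ l, toAut (ofPSL l) = MulAut.conj l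
  exists_smul_base : ∀ ω, ∃ l, ω = ofPSL l • base
  smul_base_iff : ∀ k : G, k • base = base ↔
    ∀ x, toAut k x ∈ subfieldPSL F 1 ↔ x ∈ subfieldPSL F 1

section Model

variable {K : Type*} [Field K] [Finite K]

theorem subfieldPSL_eq_map_pslLift (F : Subfield K) (g : GL (Fin 2) K) :
    (subfieldPSL F 1).map (pslLift K (slConj g)).toMonoidHom = subfieldPSL F g := by
  have h := map_pslSemi_subfieldPSL F g 1 1
  rw [map_one, mul_one] at h
  rw [← h]
  congr 1
  refine MonoidHom.ext fun x => ?_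
  obtain ⟨A, rfl⟩ := pslMk_surjective x
  rfl

theorem IsOfTypeGL2.exists_standard {G : Type*} [Group G] {F : Subfield K} {H : Subgroup G}
    (hH : IsOfTypeGL2 F H) : ∃ φ : PSL(2, K) ≃* socle G,
      H = Subgroup.normalizer
        (((subfieldPSL F 1).map ((socle G).subtype.comp φ.toMonoidHom) : Subgroup G) : Set G) := by
  obtain ⟨φ, g, h⟩ := hH
  refine ⟨MulEquiv.trans (pslLift K (slConj g)) φ, ?_⟩
  rw [h, ← subfieldPSL_eq_map_pslLift F g, Subgroup.map_map]
  rfl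

theorem exists_sublineAction {F : Subfield K} {G Ω : Type*} [Group G] [Finite Ω] [MulAction G Ω]
    [FaithfulSMul G Ω] [MulAction.IsPreprimitive G Ω] (hG : IsAlmostSimple G) (ω : Ω)
    (hH : IsOfTypeGL2 F (MulAction.stabilizer G ω)) : Nonempty (SublineAction F G Ω) := by
  have hfin : Finite G :=
    Finite.of_injective (MulAction.toPermHom G Ω) MulAction.toPerm_injective
  obtain ⟨φ, hφ⟩ := hH.exists_standard
  have hsimple := hG.1
  -- A primitive group is quasiprimitive, so a normal subgroup that moves some point is transitive.
  have htrans : MulAction.IsPretransitive (socle G) Ω := by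
    apply MulAction.IsQuasiPreprimitive.isPretransitive_of_normal (G := G)
    intro hfix
    obtain ⟨x, hx⟩ := exists_ne (1 : socle G)
    apply hx
    apply Subtype.ext
    apply FaithfulSMul.eq_of_smul_eq_smul (α := Ω)
    intro a
    have ha : a ∈ MulAction.fixedPoints (socle G) Ω := hfix ▸ Set.mem_univ a
    rw [Subgroup.coe_one, one_smul]
    exact ha x
  let ρ : G →* MulAut PSL(2, K) := (MulAut.congr φ.symm).toMonoidHom.comp MulAut.conjNormal
  have hρ : ∀ k x, (φ (ρ k x) : G) = k * φ x * k⁻¹ := by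
    intro k x
    have : φ (ρ k x) = MulAut.conjNormal k (φ x) := φ.apply_symm_apply _
    rw [this, MulAut.conjNormal_apply]
  have hinj : ∀ x y, (φ x : G) = φ y → x = y := fun x y h => φ.injective (Subtype.ext h)
  refine ⟨⟨ρ, (socle G).subtype.comp φ.toMonoidHom, ω, ?_, ?_, ?_, ?_, ?_⟩⟩
  · exact (MulAut.congr φ.symm).injective.comp hG.conjNormal_injective
  · exact fun x y h => hinj x y h
  · intro l
    ext x
    apply hinj
    rw [hρ, MulAut.conj_apply, map_mul, map_mul, map_inv]
    rfl
  · intro ω'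
    obtain ⟨s, hs⟩ := MulAction.exists_smul_eq (socle G) ω ω'
    refine ⟨φ.symm s, ?_⟩
    rw [← hs]
    change _ = ((φ (φ.symm s) : socle G) : G) • ω
    rw [φ.apply_symm_apply]
    rfl
  · intro k
    rw [← MulAction.mem_stabilizer_iff, hφ, Subgroup.mem_normalizer_iff]
    have hmem : ∀ x, ((φ x : socle G) : G) ∈
        (subfieldPSL F 1).map ((socle G).subtype.comp φ.toMonoidHom) ↔ x ∈ subfieldPSL F 1 := by
      intro x
      constructor
      · rintro ⟨y, hy, hyx⟩
        rwa [← hinj y x hyx]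
      · exact fun hx => ⟨x, hx, rfl⟩
    constructor
    · intro h x
      rw [← hmem, ← hmem, hρ, ← h]
    · intro h y
      constructor
      · rintro ⟨x, hx, rfl⟩
        change k * (φ x : G) * k⁻¹ ∈ _
        rw [← hρ, hmem, h]
        exact hx
      · rintro ⟨x, hx, hxy⟩
        have hxy : (φ x : G) = k * y * k⁻¹ := hxy
        have hy : y = φ (ρ k⁻¹ x) := by
          rw [hρ, hxy]; group
        rw [hy, hmem, ← h, ← MulAut.mul_apply, ← map_mul, mul_inv_cancel, map_one]
        exact hx

end Model

/-! ### Point stabilisers in matrix terms -/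

namespace SublineAction

variable {K : Type*} [Field K] [Finite K] {F : Subfield K} {G Ω : Type*} [Group G]
  [MulAction G Ω] (S : SublineAction F G Ω)

/-- The point corresponding to the subline with matrix `A`. -/
def pt (A : SL(2, K)) : Ω := S.ofPSL (pslMk A) • S.base

omit [Finite K] in
theorem exists_pt (ω : Ω) : ∃ A, ω = S.pt A := by
  obtain ⟨l, hl⟩ := S.exists_smul_base ω
  obtain ⟨A, rfl⟩ := pslMk_surjective l
  exact ⟨A, hl⟩

theorem smul_pt_iff {k : G} {h : GL (Fin 2) K} {σ : K ≃+* K} (hk : S.toAut k = pslSemi h σ)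
    (A : SL(2, K)) : k • S.pt A = S.pt A ↔
      HasEntriesUpToScalar F ((Matrix.SpecialLinearGroup.toGL A)⁻¹ * h *
        glMap σ (Matrix.SpecialLinearGroup.toGL A)).1 := by
  have h1 : k • S.pt A = S.pt A ↔
      ((S.ofPSL (pslMk A))⁻¹ * k * S.ofPSL (pslMk A)) • S.base = S.base := by
    rw [pt, mul_smul, mul_smul, inv_smul_eq_iff]
  have h2 : S.toAut ((S.ofPSL (pslMk A))⁻¹ * k * S.ofPSL (pslMk A)) =
      pslSemi ((Matrix.SpecialLinearGroup.toGL A)⁻¹ * h *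
        glMap σ (Matrix.SpecialLinearGroup.toGL A)) σ := by
    have h3 : ∀ g : GL (Fin 2) K, glMap 1 g = g := fun g => Units.ext rfl
    rw [map_mul, map_mul, ← map_inv, ← map_inv, S.toAut_ofPSL, S.toAut_ofPSL, hk, ← map_inv,
      conj_pslMk, conj_pslMk, pslSemi_mul, pslSemi_mul, h3, one_mul, mul_one, map_inv]
  rw [h1, S.smul_base_iff, h2]
  have h4 := map_pslSemi_subfieldPSL_eq_iff F ((Matrix.SpecialLinearGroup.toGL A)⁻¹ * h *
        glMap σ (Matrix.SpecialLinearGroup.toGL A)) σ 1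
  rw [inv_one, one_mul, map_one, mul_one] at h4
  rw [← h4]
  generalize pslSemi _ σ = α
  constructor
  · intro h
    ext y
    obtain ⟨x, rfl⟩ := α.surjective y
    rw [h]
    constructor
    · rintro ⟨z, hz, hzx⟩
      rwa [← α.injective hzx]
    · exact fun hx => ⟨x, hx, rfl⟩
  · intro h x
    constructor
    · intro hx
      rw [← h] at hx
      obtain ⟨z, hz, hzx⟩ := hx
      rwa [← α.injective hzx]
    · intro hx
      rw [← h]
      exact ⟨x, hx, rfl⟩

theorem smul_pt_iff_of_smul {k : G} {h : GL (Fin 2) K} {σ : K ≃+* K}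
    (hk : S.toAut k = pslSemi h σ) {A : SL(2, K)} {g : GL (Fin 2) K} {c : K} (hc : c ≠ 0)
    (hA : A.1 = c • g.1) :
    k • S.pt A = S.pt A ↔ HasEntriesUpToScalar F (g⁻¹ * h * glMap σ g).1 := by
  have hσ : (glMap σ (Matrix.SpecialLinearGroup.toGL A)).1 = σ c • (glMap σ g).1 := by
    ext i j
    change σ (A.1 i j) = σ c * σ (g.1 i j)
    rw [hA, ← map_mul]; rfl
  have hc' : σ c ≠ 0 := by simpa
  rw [S.smul_pt_iff hk, HasEntriesUpToScalar.conj_iff_adjugate,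
    HasEntriesUpToScalar.conj_iff_adjugate, hσ, Matrix.SpecialLinearGroup.coe_GL_coe_matrix, hA,
    Matrix.adjugate_smul, Matrix.smul_mul, Matrix.smul_mul, Matrix.mul_smul,
    HasEntriesUpToScalar.smul_iff (pow_ne_zero _ hc), HasEntriesUpToScalar.smul_iff hc']

/-- By transitivity of `L₂(K)`, `k` may be taken to fix the base point. Its matrix is then over `F`
up to a scalar, so its determinant there is a square in `K` and it can be rescaled into `SL₂(K)`. -/
theorem exists_toAut_eq (hK : Nat.card K = Nat.card F ^ 2) (k : G) :
    ∃ (A : SL(2, K)) (σ : K ≃+* K),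
      S.toAut k = pslSemi (Matrix.SpecialLinearGroup.toGL A) σ := by
  obtain ⟨l, hl⟩ := S.exists_smul_base (k • S.base)
  obtain ⟨A, rfl⟩ := pslMk_surjective l
  set k' := (S.ofPSL (pslMk A))⁻¹ * k with hk'
  have hfix : k' • S.pt 1 = S.pt 1 := by
    rw [pt, map_one, map_one, one_smul, hk', mul_smul, hl, inv_smul_smul]
  obtain ⟨h, σ, hσ⟩ := exists_eq_pslSemi (S.toAut k')
  rw [S.smul_pt_iff hσ, map_one, map_one, inv_one, one_mul, mul_one] at hfix
  obtain ⟨c, hc, hcF⟩ := hfix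
  have hdetF : (c • h.1).det ∈ F := by
    rw [Matrix.det_fin_two]
    exact F.sub_mem (F.mul_mem (hcF _ _) (hcF _ _)) (F.mul_mem (hcF _ _) (hcF _ _))
  have hdet0 : (c • h.1).det ≠ 0 := by
    rw [Matrix.det_smul]
    exact mul_ne_zero (pow_ne_zero _ hc) (Matrix.GeneralLinearGroup.det_ne_zero h)
  obtain ⟨M, d, hd, hM⟩ := exists_sl_of_isSquare_det hdet0 (F.isSquare_of_mem hK hdetF)
  have hMh : slConj h = slConj (Matrix.SpecialLinearGroup.toGL M) := by
    ext B : 1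
    rw [slConj_eq_iff]
    have h1 := (slConj_eq_iff (Matrix.SpecialLinearGroup.toGL M) B _).1 rfl
    rw [Matrix.SpecialLinearGroup.coe_GL_coe_matrix, hM, smul_smul, Matrix.smul_mul,
      Matrix.mul_smul] at h1
    exact smul_right_injective _ (mul_ne_zero hd hc) h1
  refine ⟨A * M, σ, ?_⟩
  have hkk : k = S.ofPSL (pslMk A) * k' := by rw [hk']; group
  have h3 : ∀ g : GL (Fin 2) K, glMap 1 g = g := fun g => Units.ext rfl
  have hσ' : S.toAut k' = pslSemi (Matrix.SpecialLinearGroup.toGL M) σ := by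
    rw [hσ, pslSemi, pslSemi, hMh]
  rw [hkk, map_mul, S.toAut_ofPSL, hσ', conj_pslMk, pslSemi_mul, h3, one_mul, map_mul]

end SublineAction

/-! ### Bounds for the base size -/

section BaseSize

variable {G Ω : Type*} [Group G] [MulAction G Ω]

theorem baseSize_le {n : ℕ} {Δ : Finset Ω} (hn : Δ.card ≤ n)
    (h : ∀ k : G, (∀ ω ∈ Δ, k • ω = ω) → k = 1) : baseSize G Ω ≤ n := by
  have hmem : Δ.card ∈
      {n : ℕ | ∃ Δ : Finset Ω, Δ.card = n ∧ fixingSubgroup G (Δ : Set Ω) = ⊥} := by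
    refine ⟨Δ, rfl, ?_⟩
    rw [Subgroup.eq_bot_iff_forall]
    intro k hk
    rw [mem_fixingSubgroup_iff] at hk
    exact h k fun ω hω => hk ω hω
  exact (Nat.sInf_le hmem).trans hn

/-- The base `Δ` is needed because the infimum of the empty set is `0`. -/
theorem lt_baseSize [Nonempty Ω] {n : ℕ} {Δ : Finset Ω}
    (h : ∀ k : G, (∀ ω ∈ Δ, k • ω = ω) → k = 1)
    (hn : ∀ f : Fin n → Ω, ∃ k : G, k ≠ 1 ∧ ∀ i, k • f i = f i) : n < baseSize G Ω := by
  by_contra! hle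
  obtain ⟨Γ, hΓ, hbot⟩ : baseSize G Ω ∈
      {n : ℕ | ∃ Δ : Finset Ω, Δ.card = n ∧ fixingSubgroup G (Δ : Set Ω) = ⊥} := by
    apply Nat.sInf_mem
    refine ⟨_, Δ, rfl, ?_⟩
    rw [Subgroup.eq_bot_iff_forall]
    intro k hk
    rw [mem_fixingSubgroup_iff] at hk
    exact h k fun ω hω => hk ω hω
  rw [← hΓ] at hle
  let e := Γ.equivFin
  -- A smaller base is padded to length `n` by an arbitrary point.
  let f : Fin n → Ω := fun i =>
    if hi : i.1 < Γ.card then (e.symm ⟨i.1, hi⟩ : Γ).1 else Classical.arbitrary Ω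
  obtain ⟨k, hk1, hk⟩ := hn f
  apply hk1
  rw [← Subgroup.mem_bot, ← hbot, mem_fixingSubgroup_iff]
  intro ω hω
  have h1 := (e ⟨ω, hω⟩).2
  have h2 := hk ⟨(e ⟨ω, hω⟩).1, h1.trans_le hle⟩
  simpa [f, h1] using h2

end BaseSize

/-! ### Faithfulness of the semilinear description, and the field of nine elements -/

section Kernel

variable {K : Type*} [Field K] [Finite K]

/-- A trivial automorphism preserves every form, so the triangle argument fixes each `x ∉ F`;
elements of `F` are differences of such. -/
theorem eq_one_of_pslSemi_eq_one (F : Subfield K) (hK : Nat.card K = Nat.card F ^ 2)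
    {h : GL (Fin 2) K} {σ : K ≃+* K} (H : pslSemi h σ = 1) : σ = 1 := by
  obtain ⟨τ, -, hfix, -, a, ha⟩ := F.exists_involution hK
  have haF : a ∉ F := fun h => ha ((hfix a).2 h)
  have hg : ∀ g : GL (Fin 2) K, HasEntriesUpToScalar F (g⁻¹ * h * glMap σ g).1 := fun g => by
    rw [← map_pslSemi_subfieldPSL_eq_iff, H]
    exact Subgroup.map_id _
  have key : ∀ x, x ∉ F → σ x = x := fun x hx => by
    have hx0 : x ≠ 0 := fun h => hx (h ▸ F.zero_mem)
    have hx1 : 1 - x ≠ 0 := fun h => hx (sub_eq_zero.1 h ▸ F.one_mem)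
    have h1 := hg 1
    rw [inv_one, one_mul, map_one, mul_one] at h1
    exact (scalar_of_triangle σ hx hx0 hx1 (Matrix.eta_fin_two h.1) h1 (hg _) (hg _)).2.2.2
  ext x
  rw [RingAut.one_apply]
  by_cases hx : x ∈ F
  · have h1 := key (x + a) fun h => haF (by simpa using F.sub_mem h hx)
    rw [map_add, key a haF] at h1
    exact add_right_cancel h1
  · exact key x hx

theorem scalar_of_four_lines {F : Subfield K} (σ : K ≃+* K) {a p q r s : K} (haF : a ∉ F)
    (ha : a ≠ 0) {h : GL (Fin 2) K} (hh : h.1 = !![p, q; r, s])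
    (H1 : HasEntriesUpToScalar F h.1)
    (H2 : HasEntriesUpToScalar F ((glAffine a 0 ha)⁻¹ * h * glMap σ (glAffine a 0 ha)).1)
    (H3 : HasEntriesUpToScalar F
      ((glAffine 1 a one_ne_zero)⁻¹ * h * glMap σ (glAffine 1 a one_ne_zero)).1)
    (H4 : HasEntriesUpToScalar F ((glAffine a 1 ha)⁻¹ * h * glMap σ (glAffine a 1 ha)).1) :
    q = 0 ∧ r = 0 ∧ p = s ∧ σ a = a := by
  have hdet : p * s - q * r ≠ 0 := by
    have := Matrix.GeneralLinearGroup.det_ne_zero h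
    rwa [hh, Matrix.det_fin_two_of] at this
  have hbF : σ a ∉ F := by rwa [F.map_mem_iff]
  have hb : σ a ≠ 0 := fun h => hbF (h ▸ F.zero_mem)
  have h2 := glAffine_conj_entries σ ha hh H2
  have h3 := glAffine_conj_entries σ one_ne_zero hh H3
  have h4 := glAffine_conj_entries σ ha hh H4
  rw [hh] at H1
  simp only [map_zero, zero_mul, sub_zero, mul_zero, zero_add, map_one, one_mul,
    mul_one] at h2 h3 h4
  rcases diagonal_or_antidiagonal_of_two_lines σ haF hdet H1 h2 with
    ⟨rfl, rfl, hs, hp, hps, hc⟩ | ⟨rfl, rfl, hr⟩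
  · simp only [sub_zero, zero_sub, zero_add, mul_zero, zero_mul] at h3 h4
    have v1 : (p * σ a + -(a * s)) / s ∈ F := h3.div_mem 0 1 1 1
    have v2 : (p + -s) / (a * s) ∈ F := h4.div_mem 0 1 1 1
    have e1 : p / s * (σ a / a) - 1 = 0 := Subfield.eq_zero_of_mem_of_mul_mem
      (F.sub_mem (F.mul_mem hps hc) F.one_mem) haF (by
        convert v1 using 1; field_simp; ring)
    have e2 : p / s - 1 = 0 := Subfield.eq_zero_of_mem_of_div_mem
      (F.sub_mem hps F.one_mem) haF (by convert v2 using 1; field_simp; ring)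
    rw [sub_eq_zero] at e1 e2
    rw [e2, one_mul, div_eq_one_iff_eq ha] at e1
    exact ⟨rfl, rfl, (div_eq_one_iff_eq hs).1 e2, e1⟩
  · exfalso
    have v1 := h3.div_mem 0 0 1 0
    simp only [Matrix.of_apply, Matrix.cons_val', Matrix.cons_val_zero, Matrix.cons_val_one,
      Matrix.cons_val_fin_one] at v1
    apply haF
    convert F.neg_mem v1 using 1
    field_simp
    ring

/-- A field of nine elements has only one nontrivial automorphism. -/
theorem RingEquiv.eq_of_ne_one {F : Subfield K} (hF : Nat.card F = 3) {τ : K ≃+* K}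
    (hfix : ∀ x, τ x = x ↔ x ∈ F) (hinv : ∀ x, τ (τ x) = x) {σ : K ≃+* K} (hσ : σ ≠ 1) :
    σ = τ := by
  have hσF : ∀ x ∈ F, σ x = x := fun x hx => by
    have := (F.mem_iff_pow_card_eq x).1 hx
    rw [hF] at this
    have : x * ((x - 1) * (x + 1)) = 0 := by linear_combination this
    rcases mul_eq_zero.1 this with h | h
    · simp [h]
    rcases mul_eq_zero.1 h with h | h
    · simp [sub_eq_zero.1 h]
    · simp [eq_neg_of_add_eq_zero_left h]
  -- The automorphism `σ` fixes the trace and norm of `x` over `F`, so it permutes the roots `x` and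
  -- `τ x` of the resulting quadratic.
  have hor : ∀ x, σ x = x ∨ σ x = τ x := fun x => by
    have h1 := hσF (x + τ x) ((hfix _).1 (by rw [map_add, hinv, add_comm]))
    have h2 := hσF (x * τ x) ((hfix _).1 (by rw [map_mul, hinv, mul_comm]))
    rw [map_add] at h1
    rw [map_mul] at h2
    have : (σ x - x) * (σ x - τ x) = 0 := by linear_combination σ x * h1 - h2
    exact (mul_eq_zero.1 this).imp sub_eq_zero.1 sub_eq_zero.1
  obtain ⟨x, hx⟩ : ∃ x, σ x ≠ x := by
    by_contra! h
    exact hσ (RingEquiv.ext h)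
  have hxτ := (hor x).resolve_left hx
  ext y
  refine (hor y).elim (fun hy => ?_) id
  rcases hor (x + y) with h | h
  · rw [map_add, hy] at h
    exact absurd (add_right_cancel h) hx
  · rwa [map_add, map_add, hxτ, add_right_inj] at h

omit [Finite K] in
theorem pslFieldAut_one : pslFieldAut (1 : K ≃+* K) = 1 :=
  (pslFieldAutHom K).map_one

/-- The action of `PΣL₂(K)` on `L₂(K)`. -/
def pSigmaHom (K : Type*) [Field K] : PSigmaL2 K →* MulAut PSL(2, K) :=
  SemidirectProduct.lift MulAut.conj (pslFieldAutHom K) fun σ => by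
    ext l x
    simp [MulAut.conj_apply]

omit [Finite K] in
theorem pSigmaHom_mk (A : SL(2, K)) (σ : K ≃+* K) :
    pSigmaHom K ⟨pslMk A, σ⟩ = pslSemi (Matrix.SpecialLinearGroup.toGL A) σ := by
  have h : pSigmaHom K ⟨pslMk A, σ⟩ = MulAut.conj (pslMk A) * pslFieldAut σ := rfl
  rw [h, conj_pslMk, pslSemi, pslSemi, pslFieldAut_one, mul_one]

end Kernel

/-! ### Explicit bases, and points with a common nontrivial stabiliser -/

namespace SublineAction

variable {K : Type*} [Field K] [Finite K] {F : Subfield K} {G Ω : Type*} [Group G]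
  [MulAction G Ω]

omit [Finite K] in
theorem eq_one_of_scalar (S : SublineAction F G Ω) {k : G} {h : GL (Fin 2) K} {σ : K ≃+* K}
    (hk : S.toAut k = pslSemi h σ)
    (hs : h.1 0 1 = 0 ∧ h.1 1 0 = 0 ∧ h.1 0 0 = h.1 1 1) (hσ : σ = 1) : k = 1 := by
  apply S.toAut_injective
  rw [hk, hσ, map_one]
  apply pslSemi_eq_one_of_scalar (p := h.1 0 0)
  conv_lhs => rw [Matrix.eta_fin_two h.1]
  rw [hs.1, hs.2.1, ← hs.2.2]

omit [Finite K] in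
theorem exists_pt_glAffine (b c : K) (hb : b ≠ 0) (hsq : IsSquare b) :
    ∃ (A : SL(2, K)) (d : K), d ≠ 0 ∧ A.1 = d • (glAffine b c hb).1 := by
  have hdet : (glAffine b c hb).1.det = b := by
    rw [coe_glAffine, Matrix.det_fin_two_of]; ring
  exact exists_sl_of_isSquare_det (by rwa [hdet]) (by rwa [hdet])

/-- The sides of a suitable triangle form a base. -/
theorem exists_base_triangle (S : SublineAction F G Ω) (hK : Nat.card K = Nat.card F ^ 2)
    (hF : 4 ≤ Nat.card F) :
    ∃ ω₁ ω₂ ω₃ : Ω, ∀ k : G, k • ω₁ = ω₁ → k • ω₂ = ω₂ → k • ω₃ = ω₃ → k = 1 := by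
  obtain ⟨a, haF, hsq, hsq1, hgen⟩ := F.exists_generating_square_pair hK hF
  have ha : a ≠ 0 := fun h => haF (h ▸ F.zero_mem)
  have ha1 : 1 - a ≠ 0 := fun h => haF (sub_eq_zero.1 h ▸ F.one_mem)
  obtain ⟨A₂, d₂, hd₂, hA₂⟩ := exists_pt_glAffine a 0 ha hsq
  obtain ⟨A₃, d₃, hd₃, hA₃⟩ := exists_pt_glAffine (1 - a) 1 ha1 hsq1
  refine ⟨S.pt 1, S.pt A₂, S.pt A₃, fun k h1 h2 h3 => ?_⟩
  obtain ⟨h, σ, hk⟩ := exists_eq_pslSemi (S.toAut k)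
  rw [S.smul_pt_iff hk, map_one, map_one, inv_one, one_mul, mul_one] at h1
  rw [S.smul_pt_iff_of_smul hk hd₂ hA₂] at h2
  rw [S.smul_pt_iff_of_smul hk hd₃ hA₃] at h3
  obtain ⟨e1, e2, e3, e4⟩ :=
    scalar_of_triangle σ haF ha ha1 (Matrix.eta_fin_two h.1) h1 h2 h3
  exact S.eq_one_of_scalar hk ⟨e1, e2, e3⟩ (hgen σ e4)

/-- If no field automorphisms occur, three concurrent sublines with two of them tangent form a
base. -/
theorem exists_base_of_forall_eq_one (S : SublineAction F G Ω) (hK : Nat.card K = Nat.card F ^ 2)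
    (hno : ∀ k (A : SL(2, K)) σ, S.toAut k = pslSemi (Matrix.SpecialLinearGroup.toGL A) σ →
      σ = 1) :
    ∃ ω₁ ω₂ ω₃ : Ω, ∀ k : G, k • ω₁ = ω₁ → k • ω₂ = ω₂ → k • ω₃ = ω₃ → k = 1 := by
  obtain ⟨a, haF, hsq⟩ := F.exists_isSquare_notMem hK
  have ha : a ≠ 0 := fun h => haF (h ▸ F.zero_mem)
  obtain ⟨A₂, d₂, hd₂, hA₂⟩ := exists_pt_glAffine a 0 ha hsq
  obtain ⟨A₃, d₃, hd₃, hA₃⟩ := exists_pt_glAffine 1 a one_ne_zero IsSquare.one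
  refine ⟨S.pt 1, S.pt A₂, S.pt A₃, fun k h1 h2 h3 => ?_⟩
  obtain ⟨A, σ, hk⟩ := S.exists_toAut_eq hK k
  obtain rfl := hno k A σ hk
  rw [S.smul_pt_iff hk, map_one, map_one, inv_one, one_mul, mul_one] at h1
  rw [S.smul_pt_iff_of_smul hk hd₂ hA₂] at h2
  rw [S.smul_pt_iff_of_smul hk hd₃ hA₃] at h3
  exact S.eq_one_of_scalar hk
    (scalar_of_two_parallel_lines haF ha (Matrix.eta_fin_two _) h1 h2 h3) rfl

/-- The lines `F`, `a F`, `F + a` and `a F + 1` force a scalar matrix and `σ a = a`; the only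
nontrivial automorphism is the involution, which moves `a ∉ F`. -/
theorem exists_base_four_lines (S : SublineAction F G Ω) (hK : Nat.card K = Nat.card F ^ 2)
    (hF : Nat.card F = 3) :
    ∃ ω₁ ω₂ ω₃ ω₄ : Ω, ∀ k : G, k • ω₁ = ω₁ → k • ω₂ = ω₂ → k • ω₃ = ω₃ → k • ω₄ = ω₄ →
      k = 1 := by
  obtain ⟨τ, -, hfix, hinv, -⟩ := F.exists_involution hK
  obtain ⟨a, haF, hsq⟩ := F.exists_isSquare_notMem hK
  have ha : a ≠ 0 := fun h => haF (h ▸ F.zero_mem)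
  obtain ⟨A₂, d₂, hd₂, hA₂⟩ := exists_pt_glAffine a 0 ha hsq
  obtain ⟨A₃, d₃, hd₃, hA₃⟩ := exists_pt_glAffine 1 a one_ne_zero IsSquare.one
  obtain ⟨A₄, d₄, hd₄, hA₄⟩ := exists_pt_glAffine a 1 ha hsq
  refine ⟨S.pt 1, S.pt A₂, S.pt A₃, S.pt A₄, fun k h1 h2 h3 h4 => ?_⟩
  obtain ⟨h, σ, hk⟩ := exists_eq_pslSemi (S.toAut k)
  rw [S.smul_pt_iff hk, map_one, map_one, inv_one, one_mul, mul_one] at h1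
  rw [S.smul_pt_iff_of_smul hk hd₂ hA₂] at h2
  rw [S.smul_pt_iff_of_smul hk hd₃ hA₃] at h3
  rw [S.smul_pt_iff_of_smul hk hd₄ hA₄] at h4
  obtain ⟨e1, e2, e3, e4⟩ :=
    scalar_of_four_lines σ haF ha (Matrix.eta_fin_two h.1) h1 h2 h3 h4
  refine S.eq_one_of_scalar hk ⟨e1, e2, e3⟩ (by_contra fun hσ => haF ?_)
  rwa [RingEquiv.eq_of_ne_one hF hfix hinv hσ, hfix] at e4

theorem exists_ne_one_fixing_pair (S : SublineAction F G Ω) (hK : Nat.card K = Nat.card F ^ 2)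
    (hF : 3 ≤ Nat.card F)    (ω₁ ω₂ : Ω) : ∃ k : G, k ≠ 1 ∧ k • ω₁ = ω₁ ∧ k • ω₂ = ω₂ := by
  obtain ⟨A₁, rfl⟩ := S.exists_pt ω₁
  obtain ⟨A₂, rfl⟩ := S.exists_pt ω₂
  obtain ⟨M, hM, h1, h2⟩ := exists_ne_one_normalising_pair F hK hF A₁ A₂
  have hk : S.toAut (S.ofPSL (pslMk M)) = pslSemi (Matrix.SpecialLinearGroup.toGL M) 1 := by
    rw [S.toAut_ofPSL, conj_pslMk]
  have h3 : ∀ g : GL (Fin 2) K, glMap 1 g = g := fun g => Units.ext rfl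
  refine ⟨S.ofPSL (pslMk M), ?_, ?_, ?_⟩
  · rwa [Ne, map_eq_one_iff _ S.ofPSL_injective]
  · rw [S.smul_pt_iff hk, h3, ← map_inv, ← map_mul, ← map_mul]
    exact h1
  · rw [S.smul_pt_iff hk, h3, ← map_inv, ← map_mul, ← map_mul]
    exact h2

theorem range_toAut_le (S : SublineAction F G Ω) (hK : Nat.card K = Nat.card F ^ 2) :
    S.toAut.range ≤ (pSigmaHom K).range := by
  rintro _ ⟨k, rfl⟩
  obtain ⟨A, σ, hk⟩ := S.exists_toAut_eq hK k
  exact ⟨⟨pslMk A, σ⟩, by rw [pSigmaHom_mk, hk]⟩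

omit [Finite K] in
theorem conj_mem_range (S : SublineAction F G Ω) (l : PSL(2, K)) : MulAut.conj l ∈ S.toAut.range :=
  ⟨S.ofPSL l, S.toAut_ofPSL l⟩

end SublineAction

theorem pSigmaHom_injective {K : Type*} [Field K] [Finite K] (F : Subfield K)
    (hK : Nat.card K = Nat.card F ^ 2) {G Ω : Type*} [Group G] [MulAction G Ω]
    (S : SublineAction F G Ω) : Function.Injective (pSigmaHom K) := by
  rw [injective_iff_map_eq_one]
  rintro ⟨l, σ⟩ h
  obtain ⟨A, rfl⟩ := pslMk_surjective l
  rw [pSigmaHom_mk] at h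
  obtain rfl := eq_one_of_pslSemi_eq_one F hK h
  rw [← conj_pslMk, ← S.toAut_ofPSL, map_eq_one_iff _ S.toAut_injective,
    map_eq_one_iff _ S.ofPSL_injective] at h
  rw [h]
  rfl

namespace SublineAction

variable {K : Type*} [Field K] [Finite K] {F : Subfield K} {G Ω : Type*} [Group G]
  [MulAction G Ω]

/-- Over the field of nine elements, a group involving a nontrivial field automorphism is
`PΣL₂(9)`. -/
theorem nonempty_mulEquiv_pSigma (S : SublineAction F G Ω) (hK : Nat.card K = Nat.card F ^ 2)
    (hF : Nat.card F = 3)    {k : G} {A : SL(2, K)} {σ : K ≃+* K}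
    (hk : S.toAut k = pslSemi (Matrix.SpecialLinearGroup.toGL A) σ) (hσ : σ ≠ 1) :
    Nonempty (G ≃* PSigmaL2 K) := by
  obtain ⟨τ, -, hfix, hinv, -⟩ := F.exists_involution hK
  have hrange : S.toAut.range = (pSigmaHom K).range := by
    refine le_antisymm (S.range_toAut_le hK) ?_
    rintro _ ⟨⟨l, ρ⟩, rfl⟩
    have hl : pSigmaHom K ⟨l, ρ⟩ = MulAut.conj l * pslFieldAut ρ := rfl
    rw [hl]
    refine Subgroup.mul_mem _ (S.conj_mem_range l) ?_
    by_cases hρ : ρ = 1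
    · rw [hρ, pslFieldAut_one]
      exact Subgroup.one_mem _
    · have hρσ : ρ = σ := by
        rw [RingEquiv.eq_of_ne_one hF hfix hinv hρ, RingEquiv.eq_of_ne_one hF hfix hinv hσ]
      have : pslFieldAut ρ = (MulAut.conj (pslMk A))⁻¹ * S.toAut k := by
        rw [hk, ← pSigmaHom_mk, hρσ]
        exact (inv_mul_cancel_left _ _).symm
      rw [this]
      exact Subgroup.mul_mem _ (Subgroup.inv_mem _ (S.conj_mem_range _)) ⟨k, rfl⟩
  exact ⟨((MonoidHom.ofInjective S.toAut_injective).trans (MulEquiv.subgroupCongr hrange)).trans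
    (MonoidHom.ofInjective (pSigmaHom_injective F hK S)).symm⟩

theorem exists_ne_one_fixing_triple (S : SublineAction F G Ω) (hK : Nat.card K = Nat.card F ^ 2)
    (hF : Nat.card F = 3)    (e : G ≃* PSigmaL2 K) (ω₁ ω₂ ω₃ : Ω) :
    ∃ k : G, k ≠ 1 ∧ k • ω₁ = ω₁ ∧ k • ω₂ = ω₂ ∧ k • ω₃ = ω₃ := by
  obtain ⟨A₁, rfl⟩ := S.exists_pt ω₁
  obtain ⟨A₂, rfl⟩ := S.exists_pt ω₂
  obtain ⟨A₃, rfl⟩ := S.exists_pt ω₃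
  obtain ⟨τ, hpow, hfix, hinv, x, hx⟩ := F.exists_involution hK
  obtain ⟨Z, h1, h2, h3⟩ := exists_normalising_triple hF hK hpow hfix hinv A₁ A₂ A₃
  have hι := pSigmaHom_injective F hK S
  have : Finite (MulAut PSL(2, K)) :=
    Finite.of_injective (fun α : MulAut PSL(2, K) => (α : PSL(2, K) → PSL(2, K)))
      DFunLike.coe_injective
  -- The abstract isomorphism `e` enters only through orders: the image of `G` lies in that of
  -- `PΣL₂(K)` and has the same size.
  have hrange : S.toAut.range = (pSigmaHom K).range := by
    apply Subgroup.eq_of_le_of_card_ge (S.range_toAut_le hK)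
    rw [← Nat.card_congr (MonoidHom.ofInjective hι).toEquiv,
      ← Nat.card_congr (MonoidHom.ofInjective S.toAut_injective).toEquiv,
      Nat.card_congr e.toEquiv]
  obtain ⟨k, hk⟩ : pSigmaHom K ⟨pslMk Z, τ⟩ ∈ S.toAut.range := hrange ▸ ⟨_, rfl⟩
  rw [pSigmaHom_mk] at hk
  have hmap : ∀ A : SL(2, K), glMap τ (Matrix.SpecialLinearGroup.toGL A) =
    Matrix.SpecialLinearGroup.toGL (slFieldAut τ A) := fun A => Units.ext rfl
  refine ⟨k, ?_, ?_, ?_, ?_⟩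
  · rintro rfl
    rw [map_one] at hk
    apply hx
    rw [eq_one_of_pslSemi_eq_one F hK hk.symm, RingAut.one_apply]
  · rw [S.smul_pt_iff hk, hmap, ← map_inv, ← map_mul, ← map_mul]
    exact h1
  · rw [S.smul_pt_iff hk, hmap, ← map_inv, ← map_mul, ← map_mul]
    exact h2
  · rw [S.smul_pt_iff hk, hmap, ← map_inv, ← map_mul, ← map_mul]
    exact h3

end SublineAction

/-! ### The base size -/

theorem proposition4p8
    {K : Type*} [Field K] [Finite K] (F : Subfield K) (q q₀ : ℕ)
    (hK : Nat.card K = q) (hF : Nat.card F = q₀) (hq : q = q₀ ^ 2) (hq₀ : 3 ≤ q₀)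
    {G Ω : Type*} [Group G] [Finite Ω] [MulAction G Ω] [FaithfulSMul G Ω]
    [MulAction.IsPreprimitive G Ω]
    (hG : IsAlmostSimple G) (hsoc : Nonempty (socle G ≃* PSL(2, K)))
    (ω : Ω) (hH : IsOfTypeGL2 F (MulAction.stabilizer G ω)) :
    ((q = 9 ∧ Nonempty (G ≃* PSigmaL2 K)) → baseSize G Ω = 4) ∧
    (¬ (q = 9 ∧ Nonempty (G ≃* PSigmaL2 K)) → baseSize G Ω = 3) := by
  classical
  obtain ⟨S⟩ := exists_sublineAction hG ω hH
  have : Nonempty Ω := ⟨ω⟩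
  subst hF hK
  have hq9 : Nat.card K = 9 ↔ Nat.card F = 3 := by
    rw [hq]
    constructor
    · intro h; nlinarith
    · intro h; rw [h]; norm_num
  constructor
  · rintro ⟨h9, ⟨e⟩⟩
    have h3 := hq9.1 h9
    obtain ⟨ω₁, ω₂, ω₃, ω₄, hb⟩ := S.exists_base_four_lines hq h3
    have hb' : ∀ k : G, (∀ x ∈ ({ω₁, ω₂, ω₃, ω₄} : Finset Ω), k • x = x) → k = 1 := fun k hk =>
      hb k (hk _ (by simp)) (hk _ (by simp)) (hk _ (by simp)) (hk _ (by simp))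
    refine le_antisymm (baseSize_le Finset.card_le_four hb') (lt_baseSize hb' fun f => ?_)
    obtain ⟨k, hk, h1, h2, h3⟩ := S.exists_ne_one_fixing_triple hq h3 e (f 0) (f 1) (f 2)
    exact ⟨k, hk, fun i => by fin_cases i <;> assumption⟩
  · intro hnot
    obtain ⟨ω₁, ω₂, ω₃, hb⟩ : ∃ ω₁ ω₂ ω₃ : Ω,
        ∀ k : G, k • ω₁ = ω₁ → k • ω₂ = ω₂ → k • ω₃ = ω₃ → k = 1 := by
      by_cases h4 : 4 ≤ Nat.card F
      · exact S.exists_base_triangle hq h4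
      · have h3 : Nat.card F = 3 := by omega
        refine S.exists_base_of_forall_eq_one hq fun k A σ hk => by_contra fun hσ => hnot ?_
        exact ⟨hq9.2 h3, S.nonempty_mulEquiv_pSigma hq h3 hk hσ⟩
    have hb' : ∀ k : G, (∀ x ∈ ({ω₁, ω₂, ω₃} : Finset Ω), k • x = x) → k = 1 := fun k hk =>
      hb k (hk _ (by simp)) (hk _ (by simp)) (hk _ (by simp))
    refine le_antisymm (baseSize_le Finset.card_le_three hb') (lt_baseSize hb' fun f => ?_)
    obtain ⟨k, hk, h1, h2⟩ := S.exists_ne_one_fixing_pair hq hq₀ (f 0) (f 1)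
    exact ⟨k, hk, fun i => by fin_cases i <;> assumption⟩
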